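/- Write points of $\mathbb{C}^3\times\mathbb{C}^2$ as $(a,b,c;d,e)$, let $s=d+e-a-b-c$ be the parametric excess, and let ${}_3F_2(a,b,c;d,e)=\sum_{k\ge 0}\frac{(a)_k(b)_k(c)_k}{(d)_k(e)_k\,k!}$ (argument $1$). The \emph{convergence constraints} on $(a,b,c;d,e)$ are: neither $d$ nor $e$ is a non-positive integer, and $\operatorname{Re}s>0$. The Thomae group $\mathfrak{T}\subset GL(5,\mathbb{C})$, $\mathfrak T\cong S_5$, consists of the linear maps of $(a,b,c;d,e)$ induced by all permutations of $(x,y,z,u,v)$, where $$a=x+u+v,\quad b=y+u+v,\quad c=z+u+v,\quad d=x+y+z+2u+v,\quad e=x+y+z+u+2v.$$ A gamma quotient $\Gamma\bigl[{p_1,\dots,p_k\atop q_1,\dots,q_l}\bigr]=\prod_i\Gamma(p_i)/\prod_j\Gamma(q_j)$ is $0$ if some $q_j$ and no $p_i$ is a non-positive integer; where some $p_i$ is a non-positive integer, it is understood by continuity (removable singularity) along the set on which it is considered. A set $\mathcal V\subset\mathbb{C}^3\times\mathbb{C}^2$ has the \emph{gamma quotient summation property} if there is one gamma quotient, whose arguments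 are affine functions of $(a,b,c;d,e)$ with rational coefficients, such that at every point of $\mathcal V$ that satisfies the convergence constraints, the series ${}_3F_2(a,b,c;d,e)$ converges and equals that gamma quotient (as a function on $\mathcal V$). It has the \emph{formal} gamma quotient summation property if there is one such gamma quotient that, at every $p\in\mathcal V$ and for every $T\in\mathfrak T$ for which $Tp=(a',b',c';d',e')$ satisfies the convergence constraints, equals the normalized sum ${}_3F_2(a',b',c';d',e')/\bigl(\Gamma(d')\Gamma(e')\Gamma(s')\bigr)$, $s'=d'+e'-a'-b'-c'$, with that series convergent; this normalized sum is the $\mathfrak T$-invariant form of ${}_3F_2$, so it serves as the formal normalized sum at $p$ even where ${}_3F_2(p)$ diverges. \textbf{Theorem.} For each integer $n\ge1$ there is a $\mathfrak{T}$-orbit of $3$-planes (three-dimensional affine subspaces) in $\mathbb{C}^3\times\mathbb{C}^2$, all of which have the gamma quotient summation property and the formal gamma quotient summation property. Up to separate permutations of the upper parameters $a,b,c$ and of the lower parameters $d,e$, the orbit comprises exactly five $3$-planes. Two of them are $\{(-n,a,b;\,c,1+a+b-c-n)\}$ and $\{(a,b,c;\,a-n,1+b)\}$, with $a,b,c\in\mathbb{C}$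 free, and correspond respectively to the identities (i) ${}_3F_2(-n,a,b;\,c,1+a+b-c-n)=\Gamma\left[{c-a+n,\;c-b+n,\;c,\;c-a-b\atop c-a,\;c-b,\;c+n,\;c-a-b+n}\right]$, (ii) ${}_3F_2(a,b,c;\,a-n,1+b)=\Gamma\left[{1+b-a+n,\;1-a,\;1-c,\;1+b\atop 1+b-a,\;1-a+n,\;1+b-c}\right]$. In (i) and (ii) it is assumed that no lower parameter is a non-positive integer, and in (ii) also that the parametric excess has positive real part; the gamma quotients are regarded as functions of $(a,b,c)\in\mathbb{C}^3$. The remaining three $3$-planes (up to separate permutations) consist entirely of points that violate the convergence constraints. -/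

import Mathlib

open Filter Topology

/-- Parameter space `ℂ³ × ℂ²`; the coordinates `0,1,2` are the upper parameters `α₁, α₂, α₃`
and the coordinates `3,4` are the lower parameters `β₁, β₂`. -/
abbrev Params : Type := Fin 5 → ℂ

/-- `z` is a non-positive integer. -/
def IsNonposInt (z : ℂ) : Prop := ∃ m : ℕ, z = -(m : ℂ)

/-- The `k`-th term of the series `₃F₂(α₁, α₂, α₃; β₁, β₂; 1)`. -/
noncomputable def hyperTerm (p : Params) (k : ℕ) : ℂ :=
  (ascPochhammer ℂ k).eval (p 0) * (ascPochhammer ℂ k).eval (p 1) *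
      (ascPochhammer ℂ k).eval (p 2) /
    ((ascPochhammer ℂ k).eval (p 3) * (ascPochhammer ℂ k).eval (p 4) * (k.factorial : ℂ))

/-- The parametric excess `s = β₁ + β₂ - α₁ - α₂ - α₃`. -/
def parametricExcess (p : Params) : ℂ := p 3 + p 4 - p 0 - p 1 - p 2

/-- The constraints under which `₃F₂(p; 1)` is defined and convergent: no lower parameter is a
non-positive integer, and the parametric excess has positive real part. -/
def ConvergentParams (p : Params) : Prop :=
  ¬ IsNonposInt (p 3) ∧ ¬ IsNonposInt (p 4) ∧ 0 < (parametricExcess p).re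

/-! ### Gamma quotients -/

/-- The gamma quotient `∏ Γ(numᵢ(q)) / ∏ Γ(denⱼ(q))`.  As `Complex.Gamma` and division by zero
take the value `0`, it is `0` when some denominator argument is a non-positive integer. -/
noncomputable def gammaQuotient {X : Type} (num den : List (X → ℂ)) (q : X) : ℂ :=
  (num.map fun f => Complex.Gamma (f q)).prod / (den.map fun f => Complex.Gamma (f q)).prod

/-- The points at which no numerator argument is a non-positive integer. -/
def regularSet {X : Type} (num : List (X → ℂ)) : Set X :=
  {q | ∀ f ∈ num, ¬ IsNonposInt (f q)}

/-- `w` is the value at `p` of the gamma quotient with numerator arguments `num` and denominator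
arguments `den`, regarded as a function on `S`.  At a point `p` of `S` in the regular set this
says that `w` equals `gammaQuotient num den p`; at a point where a numerator gamma function has a
pole it says that the singularity is removable (the point is a limit of regular points of `S`)
and that `w` is the value obtained by continuity along `S`. -/
def IsGammaQuotientValue {X : Type} [TopologicalSpace X] (S : Set X) (num den : List (X → ℂ))
    (p : X) (w : ℂ) : Prop :=
  p ∈ closure (S ∩ regularSet num) ∧
    Tendsto (gammaQuotient num den) (𝓝[S ∩ regularSet num] p) (𝓝 w)

/-- An affine function on the parameter space with rational coefficients. -/
structure RatAffine where
  const : ℚ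
  coeff : Fin 5 → ℚ

/-- Evaluation of a rational affine function. -/
def RatAffine.eval (f : RatAffine) (p : Params) : ℂ :=
  (f.const : ℂ) + ∑ i, (f.coeff i : ℂ) * p i

/-- The gamma quotient summation property of `V`: at every point of `V` that satisfies the
convergence constraints, the series `₃F₂(1)` converges, and its sum is the value of one
fixed gamma quotient with rational affine arguments. -/
def HasGammaQuotientSummation (V : Set Params) : Prop :=
  ∃ num den : List RatAffine, ∀ p ∈ V, ConvergentParams p →
    ∃ w : ℂ, HasSum (hyperTerm p) w ∧
      IsGammaQuotientValue V (num.map RatAffine.eval) (den.map RatAffine.eval) p w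

/-! ### The Thomae group -/

/-- The matrix `A` with `(a,b,c;d,e) = (x,y,z;u,v) A`. -/
def thomaeA : Matrix (Fin 5) (Fin 5) ℂ :=
  !![1, 0, 0, 1, 1;
     0, 1, 0, 1, 1;
     0, 0, 1, 1, 1;
     1, 1, 1, 2, 1;
     1, 1, 1, 1, 2]

/-- The inverse of `thomaeA`. -/
noncomputable def thomaeAInv : Matrix (Fin 5) (Fin 5) ℂ :=
  (1 / 3 : ℂ) • !![ 1, -2, -2,  1,  1;
                   -2,  1, -2,  1,  1;
                   -2, -2,  1,  1,  1;
                    1,  1,  1,  1, -2;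
                    1,  1,  1, -2,  1]

theorem thomaeA_mul_inv : thomaeA * thomaeAInv = 1 := by
  ext i j
  fin_cases i <;> fin_cases j <;>
    simp [thomaeA, thomaeAInv, Matrix.mul_apply, Fin.sum_univ_five] <;> norm_num

theorem thomaeAInv_mul : thomaeAInv * thomaeA = 1 := by
  rw [mul_eq_one_comm]
  exact thomaeA_mul_inv

/-- The linear change of coordinates `(x,y,z;u,v) ↦ (x,y,z;u,v) A = (a,b,c;d,e)`. -/
noncomputable def fromSymmetric : Params ≃ₗ[ℂ] Params :=
  LinearEquiv.ofLinearMap (Matrix.vecMulLinear thomaeA) (Matrix.vecMulLinear thomaeAInv)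
    (by
      refine LinearMap.ext fun p => ?_
      change Matrix.vecMul (Matrix.vecMul p thomaeAInv) thomaeA = p
      rw [Matrix.vecMul_vecMul, thomaeAInv_mul, Matrix.vecMul_one])
    (by
      refine LinearMap.ext fun p => ?_
      change Matrix.vecMul (Matrix.vecMul p thomaeA) thomaeAInv = p
      rw [Matrix.vecMul_vecMul, thomaeA_mul_inv, Matrix.vecMul_one])

/-- The transformation of `(a,b,c;d,e)` that permutes `(x,y,z;u,v)` by `σ`. -/
noncomputable def thomaeMap (σ : Equiv.Perm (Fin 5)) : Params ≃ₗ[ℂ] Params :=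
  fromSymmetric.symm.trans ((LinearEquiv.funCongrLeft ℂ ℂ σ).trans fromSymmetric)

/-- The Thomae group `𝔗 ⊂ GL(5, ℂ)`: all `5!` permutations of `(x,y,z;u,v)`. -/
noncomputable def thomaeGroup : Subgroup (Params ≃ₗ[ℂ] Params) where
  carrier := Set.range thomaeMap
  one_mem' := ⟨1, by ext p i; simp [thomaeMap, LinearEquiv.funCongrLeft_apply]⟩
  mul_mem' := by
    rintro _ _ ⟨σ, rfl⟩ ⟨τ, rfl⟩
    refine ⟨τ * σ, ?_⟩
    ext p i
    simp [thomaeMap, LinearMap.funLeft, Function.comp_def]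
  inv_mem' := by
    rintro _ ⟨σ, rfl⟩
    refine ⟨σ⁻¹, ?_⟩
    rw [eq_comm, inv_eq_iff_mul_eq_one]
    ext p i
    simp [thomaeMap, LinearMap.funLeft, Function.comp_def]

/-- The image of an affine subspace under an invertible linear map. -/
def imagePlane (T : Params ≃ₗ[ℂ] Params) (V : AffineSubspace ℂ Params) :
    AffineSubspace ℂ Params :=
  V.map (T : Params →ₗ[ℂ] Params).toAffineMap

/-- `O` is an orbit of the Thomae group in the set of affine subspaces. -/
def IsThomaeOrbit (O : Set (AffineSubspace ℂ Params)) : Prop :=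
  ∃ V : AffineSubspace ℂ Params, O = {W | ∃ T ∈ thomaeGroup, W = imagePlane T V}

/-- A `3`-plane: a (non-empty) three-dimensional affine subspace. -/
def IsThreePlane (V : AffineSubspace ℂ Params) : Prop :=
  (V : Set Params).Nonempty ∧ Module.finrank ℂ V.direction = 3

/-- `V` and `W` differ by separate permutations of the upper and of the lower parameters. -/
def SeparatePermEquiv (V W : AffineSubspace ℂ Params) : Prop :=
  ∃ σ : Equiv.Perm (Fin 5), (∀ i, σ i < 3 ↔ i < 3) ∧
    W = imagePlane (LinearEquiv.funCongrLeft ℂ ℂ σ) V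

/-- The formal version of the gamma quotient summation property, which also makes sense where
`₃F₂(p; 1)` itself diverges.  The normalized sum `₃F₂(q; 1) / (Γ(β₁) Γ(β₂) Γ(s))` is invariant
under the Thomae group, so its formal value at `p` is its value at any transform `T p`
that satisfies the convergence constraints.  The property says that on `V` all these formal
values are given by one gamma quotient with rational affine arguments. -/
def HasFormalGammaQuotientSummation (V : Set Params) : Prop :=
  ∃ num den : List RatAffine, ∀ p ∈ V, ∀ T ∈ thomaeGroup, ConvergentParams (T p) →
    ∃ w : ℂ, HasSum (hyperTerm (T p)) w ∧
      IsGammaQuotientValue V (num.map RatAffine.eval) (den.map RatAffine.eval) p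
        (w / (Complex.Gamma (T p 3) * Complex.Gamma (T p 4) *
          Complex.Gamma (parametricExcess (T p))))

/-! In the symmetric coordinates the Pfaff-Saalschütz plane is `x + u + v = -n`, `x + y + z = 1`
(`symPlane`). It is preserved by swapping `y, z` and by swapping `u, v`, while separate permutations
of `(a,b,c)` and of `(d,e)` are separate permutations of `(x,y,z)` and of `(u,v)`. The planes of the
orbit, up to separate permutations, therefore correspond to double cosets in `S₅`, and there are
five: it only matters where `x` and the pairs `{y,z}`, `{u,v}` sit relative to the three upper and
two lower slots. Two double cosets give the planes of (i) and (ii). On the other three either `s =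
-n` or a lower parameter equals `1 - n`, so nothing converges.

Both identities are proved directly. For (i), the terminating sum is cleared of denominators and
evaluated by induction on `n` with a telescoping correction (`sum_saalTerm`). For (ii), `(a)_k /
(a-n)_k` is a polynomial of degree `n` in `k` and `(b)_k / (1+b)_k = b / (b+k)`. Polynomials of
degree below `-re c` are orthogonal to the coefficients `(c)_k / k!`, so the polynomial may be
replaced by its value at `k = -b`, and a Beta integral remains (`hasSum_binCoeff_mul_prod_div`).

Divided by `Γ(d)Γ(e)Γ(s)`, both sums become the same entire function `normValue` of `(x,y,z,u,v)` on
the plane, and `normValue` is invariant under the two swaps. The formal property thus follows from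
the double coset decomposition and the two identities, without the general Thomae transformation
(`hasNormalizedSum_of_mem_symPlane`). The ordinary property follows on multiplying back by the three
gamma factors. -/

theorem HasSum.of_eq {f g : ℕ → ℂ} {a b : ℂ} (h : HasSum f a) (hfg : ∀ k, g k = f k)
    (hab : b = a) : HasSum g b := by
  rwa [hab, funext hfg]

/-! ### Rising factorials -/

/-- The rising factorial `(z)_k`. -/
noncomputable def rising (z : ℂ) (k : ℕ) : ℂ := (ascPochhammer ℂ k).eval z

@[simp] theorem rising_zero (z : ℂ) : rising z 0 = 1 := by simp [rising]

theorem rising_succ (z : ℂ) (k : ℕ) : rising z (k + 1) = rising z k * (z + k) :=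
  ascPochhammer_succ_eval k z

theorem rising_succ_left (z : ℂ) (k : ℕ) : rising z (k + 1) = z * rising (z + 1) k := by
  simp [rising, ascPochhammer_succ_left]

theorem rising_eq_prod (z : ℂ) (k : ℕ) : rising z k = ∏ j ∈ Finset.range k, (z + j) := by
  induction k with
  | zero => simp
  | succ k ih => rw [rising_succ, ih, Finset.prod_range_succ]

theorem continuous_rising (k : ℕ) : Continuous fun z => rising z k :=
  (ascPochhammer ℂ k).continuous

theorem rising_ne_zero {z : ℂ} (k : ℕ) (hz : ¬ IsNonposInt z) : rising z k ≠ 0 := by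
  rw [rising_eq_prod, Finset.prod_ne_zero_iff]
  exact fun j _ h => hz ⟨j, eq_neg_of_add_eq_zero_left h⟩

theorem rising_neg_natCast_eq_zero {m k : ℕ} (h : m < k) : rising (-(m : ℂ)) k = 0 := by
  rw [rising_eq_prod]
  exact Finset.prod_eq_zero (Finset.mem_range.2 h) (by simp)

/-- Reversal of the factors of a rising factorial. -/
theorem rising_reflect (z : ℂ) (n : ℕ) : rising (1 - z - n) n = (-1) ^ n * rising z n := by
  have hconst : ((-1 : ℂ)) ^ n = ∏ _j ∈ Finset.range n, (-1 : ℂ) := by simp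
  rw [rising_eq_prod, rising_eq_prod, ← Finset.prod_range_reflect, hconst,
    ← Finset.prod_mul_distrib]
  refine Finset.prod_congr rfl fun j hj => ?_
  have hj' := Finset.mem_range.1 hj
  have : ((n - 1 - j : ℕ) : ℂ) = n - 1 - j := by
    rw [Nat.sub_sub, Nat.cast_sub (by omega)]; push_cast; ring
  rw [this]; ring

/-- This form of the reflection suits the planes: there the relevant pairs of arguments add up to `1
- n`. -/
theorem rising_eq_of_add_eq {y z : ℂ} {n : ℕ} (h : y + z = 1 - n) :
    rising y n = (-1) ^ n * rising z n := by
  rw [← rising_reflect]; congr 1; linear_combination h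

/-- Poles need no exclusion: `Complex.Gamma` is `0` there, so its inverse is the entire function
`1/Γ`. -/
theorem inv_Gamma_eq (z : ℂ) (n : ℕ) :
    (Complex.Gamma z)⁻¹ = rising z n * (Complex.Gamma (z + n))⁻¹ := by
  induction n with
  | zero => simp
  | succ n ih =>
    rw [ih, Complex.one_div_Gamma_eq_self_mul_one_div_Gamma_add_one (z + n), rising_succ]
    push_cast; ring_nf

theorem Gamma_ne_zero' {z : ℂ} (hz : ¬ IsNonposInt z) : Complex.Gamma z ≠ 0 :=
  Complex.Gamma_ne_zero fun m h => hz ⟨m, h⟩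

theorem Gamma_add_nat {z : ℂ} (hz : ¬ IsNonposInt z) (n : ℕ) :
    Complex.Gamma (z + n) = rising z n * Complex.Gamma z := by
  have := Complex.Gamma_add_nat_div_Gamma_eq (n := n) z fun m h => hz ⟨m, h⟩
  rw [div_eq_iff (Gamma_ne_zero' hz)] at this
  exact this

/-! ### The binomial coefficients `(c)_k / k!` -/

/-- The coefficients of the binomial series of `(1 - t) ^ (-c)`. -/
noncomputable def binCoeff (c : ℂ) (k : ℕ) : ℂ := rising c k / k.factorial

theorem binCoeff_succ (c : ℂ) (k : ℕ) : (k + 1) * binCoeff c (k + 1) = (c + k) * binCoeff c k := by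
  have h1 : (k.factorial : ℂ) ≠ 0 := by exact_mod_cast k.factorial_ne_zero
  have h2 : (k + 1 : ℂ) ≠ 0 := by exact_mod_cast k.succ_ne_zero
  simp only [binCoeff, rising_succ, Nat.factorial_succ]
  push_cast
  field_simp

theorem succ_mul_binCoeff_succ (c : ℂ) (k : ℕ) :
    (k + 1) * binCoeff c (k + 1) = c * binCoeff (c + 1) k := by
  have h1 : (k.factorial : ℂ) ≠ 0 := by exact_mod_cast k.factorial_ne_zero
  have h2 : (k + 1 : ℂ) ≠ 0 := by exact_mod_cast k.succ_ne_zero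
  simp only [binCoeff, rising_succ_left, Nat.factorial_succ]
  push_cast
  field_simp

theorem sum_binCoeff (c : ℂ) (N : ℕ) :
    ∑ k ∈ Finset.range (N + 1), binCoeff c k = binCoeff (c + 1) N := by
  induction N with
  | zero => simp [binCoeff]
  | succ N ih =>
    have h2 : (N + 1 : ℂ) ≠ 0 := by exact_mod_cast N.succ_ne_zero
    rw [Finset.sum_range_succ, ih]
    apply mul_left_cancel₀ h2
    rw [mul_add, binCoeff_succ (c + 1), succ_mul_binCoeff_succ]; ring

/-- Euler's limit for `Γ(c)` says that `(c)_k / k!` is asymptotic to `k^(c-1) / Γ(c)`. When `c` is a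
non-positive integer the coefficients are eventually zero. -/
theorem binCoeff_isBigO (c : ℂ) :
    binCoeff c =O[atTop] fun k : ℕ => (k : ℝ) ^ (c.re - 1) := by
  by_cases hc : IsNonposInt c
  · obtain ⟨m, rfl⟩ := hc
    refine Asymptotics.IsBigO.of_bound 0 ?_
    filter_upwards [eventually_gt_atTop m] with k hk
    simp [binCoeff, rising_neg_natCast_eq_zero hk]
  have hT := (Complex.GammaSeq_tendsto_Gamma c).inv₀ (Gamma_ne_zero' hc)
  have hT2 : Tendsto (fun k : ℕ => (1 + c / k)⁻¹) atTop (𝓝 ((1 + 0)⁻¹)) := by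
    refine Tendsto.inv₀ (tendsto_const_nhds.add ?_) (by simp)
    exact tendsto_const_div_atTop_nhds_zero_nat c
  have hO := (hT.mul hT2).isBigO_one ℝ
  have hO2 : (fun k : ℕ => (k : ℂ) ^ (c - 1)) =O[atTop] fun k : ℕ => (k : ℝ) ^ (c.re - 1) := by
    refine Asymptotics.IsBigO.of_bound 1 ?_
    filter_upwards [eventually_gt_atTop 0] with k hk
    rw [Complex.norm_natCast_cpow_of_pos hk, Real.norm_of_nonneg (by positivity)]
    simp
  refine ((hO.mul hO2).congr' ?_ ?_)
  · filter_upwards [eventually_gt_atTop 0] with k hk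
    have hk' : (k : ℂ) ≠ 0 := by exact_mod_cast hk.ne'
    have h1 : (k.factorial : ℂ) ≠ 0 := by exact_mod_cast k.factorial_ne_zero
    have hck : c + k ≠ 0 := fun h => hc ⟨k, eq_neg_of_add_eq_zero_left h⟩
    have h3 : (1 + c / k)⁻¹ = k / (c + k) := by
      rw [show (1 + c / k) = (c + k) / k by field_simp; ring, inv_div]
    have h4 : (k : ℂ) ^ c ≠ 0 := by simp [Complex.cpow_eq_zero_iff, hk']
    rw [h3, Complex.GammaSeq, ← rising_eq_prod, rising_succ, binCoeff, Complex.cpow_sub _ _ hk',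
      Complex.cpow_one]
    field_simp
  · simp

theorem summable_norm_binCoeff {c : ℂ} (hc : c.re < 0) : Summable fun k => ‖binCoeff c k‖ :=
  summable_of_isBigO_nat (Real.summable_nat_rpow.2 (by linarith)) (binCoeff_isBigO c).norm_left

theorem tendsto_binCoeff {c : ℂ} (hc : c.re < 1) : Tendsto (binCoeff c) atTop (𝓝 0) := by
  refine (binCoeff_isBigO c).trans_tendsto ?_
  have := (tendsto_rpow_neg_atTop (y := 1 - c.re) (by linarith)).comp tendsto_natCast_atTop_atTop
  simpa [Function.comp_def] using this

/-- The partial sums are themselves binomial coefficients, with `c + 1` in place of `c`, and tend to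
zero. -/
theorem hasSum_binCoeff {c : ℂ} (hc : c.re < 0) : HasSum (binCoeff c) 0 := by
  have h := (summable_norm_binCoeff hc).of_norm.hasSum
  have h1 := (tendsto_add_atTop_iff_nat 1).2 h.tendsto_sum_nat
  simp only [sum_binCoeff] at h1
  rwa [tendsto_nhds_unique h1 (tendsto_binCoeff (by simpa using hc))] at h

theorem binCoeff_eq_choose (c : ℂ) (k : ℕ) : binCoeff c k = Ring.choose (c + k - 1) k := by
  have h1 : (k.factorial : ℂ) ≠ 0 := by exact_mod_cast k.factorial_ne_zero
  have h := Ring.factorial_nsmul_multichoose_eq_ascPochhammer c k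
  rw [Polynomial.ascPochhammer_smeval_eq_eval, Ring.multichoose_eq, nsmul_eq_mul] at h
  rw [binCoeff, rising, ← h]
  field_simp

theorem hasSum_binCoeff_mul_pow (c : ℂ) {t : ℂ} (ht : ‖t‖ < 1) :
    HasSum (fun k => binCoeff c k * t ^ k) ((1 - t) ^ (-c)) := by
  have h := (Complex.one_div_one_sub_cpow_hasFPowerSeriesOnBall_zero c).hasSum (y := t)
    (by simpa [← ENNReal.ofReal_one, Metric.eball_ofReal] using ht)
  simpa only [FormalMultilinearSeries.ofScalars_apply_eq, zero_add, one_div, smul_eq_mul,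
    ← Complex.cpow_neg, ← binCoeff_eq_choose] using h

/-- A polynomial of degree less than `-re c` is orthogonal to the binomial coefficients. -/
theorem hasSum_binCoeff_mul_prod (n : ℕ) : ∀ (c : ℂ) (α : ℕ → ℂ), c.re < -n →
    HasSum (fun k : ℕ => binCoeff c k * ∏ i ∈ Finset.range n, (α i + k)) 0 := by
  induction n with
  | zero => intro c α hc; simpa using hasSum_binCoeff (by simpa using hc)
  | succ n ih =>
    intro c α hc
    push_cast at hc
    have h1 := (ih c α (by linarith)).mul_left (α n)
    have h2 := (ih (c + 1) (fun i => α i + 1) (by simp; linarith)).mul_left c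
    -- A factor `k` is absorbed by `k (c)_k / k! = c (c+1)_{k-1} / (k-1)!`; the index shift raises
    -- every `α i` by one, and the term `k = 0` vanishes.
    have h3 : HasSum (fun k : ℕ => k * binCoeff c k * ∏ i ∈ Finset.range n, (α i + k)) (c * 0) := by
      rw [← hasSum_nat_add_iff' 1]
      simp only [Finset.range_one, Finset.sum_singleton, Nat.cast_zero, zero_mul, sub_zero]
      refine h2.of_eq (fun k => ?_) rfl
      rw [← mul_assoc, ← succ_mul_binCoeff_succ]
      push_cast
      congr 1
      exact Finset.prod_congr rfl fun i _ => by ring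
    refine (h1.add h3).of_eq (fun k => ?_) ?_
    · rw [Finset.prod_range_succ]; ring
    · simp

/-! ### Partial fractions: `∑ (c)_k / (k! (b + k))` -/

theorem summable_binCoeff_div {c : ℂ} (hc : c.re < 0) (b : ℂ) :
    Summable fun k : ℕ => binCoeff c k / (b + k) := by
  refine summable_of_isBigO_nat (summable_norm_binCoeff hc) ?_
  refine Asymptotics.IsBigO.of_bound 1 ?_
  filter_upwards [eventually_ge_atTop (⌈‖b‖⌉₊ + 1)] with k hk
  have h1 : ‖b‖ + 1 ≤ k := by
    have := Nat.le_ceil ‖b‖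
    have h : ((⌈‖b‖⌉₊ + 1 : ℕ) : ℝ) ≤ k := by exact_mod_cast hk
    push_cast at h; linarith
  have h2 : 1 ≤ ‖b + k‖ := by
    have := norm_sub_norm_le (k : ℂ) (-b)
    rw [norm_neg, Complex.norm_natCast, sub_neg_eq_add, add_comm] at this
    rw [add_comm] at this
    rw [add_comm]; linarith
  rw [norm_div, norm_norm, one_mul]
  exact div_le_self (norm_nonneg _) h2

/-- Expand `(1 - t)^(-c)` in the Beta integral `B(b, 1 - c)` and integrate termwise; `∑ |(c)_k / k!|
t^(re b - 1)` is an integrable majorant. -/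
theorem hasSum_binCoeff_div_of_re_pos {c b : ℂ} (hc : c.re < 0) (hb : 0 < b.re) :
    HasSum (fun k : ℕ => binCoeff c k / (b + k))
      (Complex.Gamma b * Complex.Gamma (1 - c) / Complex.Gamma (1 + b - c)) := by
  have hbeta := Complex.betaIntegral_eq_Gamma_mul_div b (1 - c) hb (by simp; linarith)
  rw [show b + (1 - c) = 1 + b - c by ring] at hbeta
  rw [← hbeta, Complex.betaIntegral]
  have key := intervalIntegral.hasSum_integral_of_dominated_convergence (μ := MeasureTheory.volume)
    (a := 0) (b := 1)
    (F := fun (k : ℕ) (t : ℝ) => binCoeff c k * (t : ℂ) ^ (b + k - 1))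
    (f := fun t : ℝ => (t : ℂ) ^ (b - 1) * (1 - (t : ℂ)) ^ (1 - c - 1))
    (fun k t => ‖binCoeff c k‖ * t ^ (b.re - 1)) ?_ ?_ ?_ ?_ ?_
  · refine key.of_eq (fun k => ?_) rfl
    rw [intervalIntegral.integral_const_mul, integral_cpow (Or.inl (by simp; positivity))]
    have hb' : b + k ≠ 0 := fun h => by
      have := congrArg Complex.re h
      simp at this
      have : (0:ℝ) ≤ k := k.cast_nonneg
      linarith
    simp [Complex.zero_cpow hb', div_eq_mul_inv]
  · intro k
    refine (Measurable.aestronglyMeasurable ?_)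
    fun_prop
  · intro k
    refine .of_forall fun t ht => ?_
    rw [Set.uIoc_of_le zero_le_one] at ht
    rw [norm_mul, Complex.norm_cpow_eq_rpow_re_of_pos ht.1]
    refine mul_le_mul_of_nonneg_left ?_ (norm_nonneg _)
    refine Real.rpow_le_rpow_of_exponent_ge ht.1 ht.2 ?_
    simp
  · exact .of_forall fun t _ => (summable_norm_binCoeff hc).mul_right _
  · simp only [tsum_mul_right]
    exact (intervalIntegral.intervalIntegrable_rpow' (by linarith)).const_mul _
  -- The binomial series is available only for `|t| < 1`, so the endpoint is discarded as a null
  -- set.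
  · have : ∀ᵐ t : ℝ ∂MeasureTheory.volume, t ≠ 1 := by
      simp [MeasureTheory.ae_iff]
    filter_upwards [this] with t ht1 ht
    rw [Set.uIoc_of_le zero_le_one] at ht
    have hlt : t < 1 := lt_of_le_of_ne ht.2 ht1
    have h := (hasSum_binCoeff_mul_pow c (t := (t : ℂ))
      (by rw [Complex.norm_real, Real.norm_of_nonneg ht.1.le]; exact hlt)).mul_left
        ((t : ℂ) ^ (b - 1))
    have ht0 : (t : ℂ) ≠ 0 := by exact_mod_cast ht.1.ne'
    refine h.of_eq (fun k => ?_) ?_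
    · rw [show b + k - 1 = (b - 1) + k by ring, Complex.cpow_add _ _ ht0, Complex.cpow_natCast]
      ring
    · ring_nf

/-- The difference of the two series telescopes. This relation carries the Beta evaluation from `re
b > 0` to all admissible `b`. -/
theorem binCoeff_div_recurrence {c b : ℂ} (hc : c.re < 0) (hb : ¬ IsNonposInt b) :
    (1 + b - c) * ∑' k : ℕ, binCoeff c k / (b + 1 + k) = b * ∑' k : ℕ, binCoeff c k / (b + k) := by
  have h1 := (summable_binCoeff_div hc (b + 1)).hasSum.mul_left (1 + b - c)
  have h2 := (summable_binCoeff_div hc b).hasSum.mul_left b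
  have h := (h1.sub h2).tendsto_sum_nat
  have hb' : ∀ k : ℕ, b + k ≠ 0 := fun k h => hb ⟨k, eq_neg_of_add_eq_zero_left h⟩
  have hpart : ∀ N : ℕ, ∑ k ∈ Finset.range N, ((1 + b - c) * (binCoeff c k / (b + 1 + k)) -
      b * (binCoeff c k / (b + k))) = -(N * binCoeff c N / (b + N)) := by
    intro N
    induction N with
    | zero => simp
    | succ N ih =>
      have h3 := hb' N
      have h4 := hb' (N + 1)
      rw [Finset.sum_range_succ, ih]
      push_cast at h4 ⊢
      rw [binCoeff_succ]
      have h5 : b + 1 + N ≠ 0 := by convert h4 using 1; ring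
      field_simp
      ring
  -- Since `N / (b + N) = 1 - b / (b + N)`, this is a difference of two null sequences.
  have hlim : Tendsto (fun N : ℕ => -(N * binCoeff c N / (b + N))) atTop (𝓝 0) := by
    have h3 := (tendsto_binCoeff (c := c) (by linarith)).sub
      ((summable_binCoeff_div hc b).tendsto_atTop_zero.const_mul b)
    refine (h3.neg.congr fun N => ?_).trans (by simp)
    have := hb' N
    field_simp
    ring
  simp only [hpart] at h
  exact sub_eq_zero.1 (tendsto_nhds_unique h hlim)

theorem hasSum_binCoeff_div {c b : ℂ} (hc : c.re < 0) (hb : ¬ IsNonposInt b) :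
    HasSum (fun k : ℕ => binCoeff c k / (b + k))
      (Complex.Gamma b * Complex.Gamma (1 - c) / Complex.Gamma (1 + b - c)) := by
  obtain ⟨m, hm⟩ := exists_nat_gt (-b.re)
  induction m generalizing b with
  | zero => exact hasSum_binCoeff_div_of_re_pos hc (by simpa using hm)
  | succ m ih =>
    have hb0 : b ≠ 0 := fun h => hb ⟨0, by simpa using h⟩
    have hb1 : ¬ IsNonposInt (b + 1) := by
      rintro ⟨j, hj⟩
      exact hb ⟨j + 1, by push_cast; linear_combination hj⟩
    have h1 := (ih hb1 (by push_cast at hm; simp; linarith)).tsum_eq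
    have h2 := binCoeff_div_recurrence hc hb
    rw [h1] at h2
    have h3 := (summable_binCoeff_div hc b).hasSum
    convert h3 using 1
    apply mul_left_cancel₀ hb0
    rw [← h2, Complex.Gamma_add_one b hb0, div_eq_mul_inv,
      Complex.one_div_Gamma_eq_self_mul_one_div_Gamma_add_one (1 + b - c)]
    rw [show 1 + (b + 1) - c = 1 + b - c + 1 by ring]
    ring

/-- Partial fractions with a polynomial numerator. -/
theorem hasSum_binCoeff_mul_prod_div (n : ℕ) {c b : ℂ} (hb : ¬ IsNonposInt b) (α : ℕ → ℂ)
    (hc : c.re < 1 - n) (hc0 : c.re < 0) :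
    HasSum (fun k : ℕ => binCoeff c k * (∏ i ∈ Finset.range n, (α i + k)) / (b + k))
      ((∏ i ∈ Finset.range n, (α i - b)) *
        (Complex.Gamma b * Complex.Gamma (1 - c) / Complex.Gamma (1 + b - c))) := by
  induction n with
  | zero => simpa using hasSum_binCoeff_div hc0 hb
  | succ n ih =>
    push_cast at hc
    -- Split `α n + k = (α n - b) + (b + k)`: the second summand cancels the denominator and
    -- contributes zero by orthogonality.
    have h1 := (ih (by linarith)).mul_left (α n - b)
    have h2 := hasSum_binCoeff_mul_prod n c α (by linarith)
    refine (h1.add h2).of_eq (fun k => ?_) ?_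
    · have hb' : b + k ≠ 0 := fun h => hb ⟨k, eq_neg_of_add_eq_zero_left h⟩
      rw [Finset.prod_range_succ]
      field_simp
      ring
    · rw [Finset.prod_range_succ]; ring

/-! ### The two summation formulas -/

theorem rising_add (z : ℂ) (m k : ℕ) : rising z (m + k) = rising z m * rising (z + m) k := by
  induction k with
  | zero => simp
  | succ k ih => rw [← add_assoc, rising_succ, ih, rising_succ]; push_cast; ring

theorem hyperTerm_eq (p : Params) (k : ℕ) : hyperTerm p k =
    rising (p 0) k * rising (p 1) k * rising (p 2) k /
      (rising (p 3) k * rising (p 4) k * k.factorial) := rfl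

/-- The sum of the series `₃F₂(a, b, c; a - n, 1 + b)`. -/
theorem hasSum_hyperTerm_shifted {n : ℕ} (hn : 1 ≤ n) {a b c : ℂ} (ha : ¬ IsNonposInt (a - n))
    (hb : ¬ IsNonposInt (1 + b)) (hc : c.re < 1 - n) :
    HasSum (hyperTerm ![a, b, c, a - n, 1 + b])
      (rising (1 + b - a) n / rising (1 - a) n *
        (Complex.Gamma (1 + b) * Complex.Gamma (1 - c) / Complex.Gamma (1 + b - c))) := by
  have hn' : (1 : ℝ) ≤ n := by exact_mod_cast hn
  have hd : ∀ k, rising (a - n) k ≠ 0 := fun k => rising_ne_zero k ha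
  have he : ∀ k, rising (1 + b) k ≠ 0 := fun k => rising_ne_zero k hb
  have hrefl : rising (a - n) n = (-1) ^ n * rising (1 - a) n := rising_eq_of_add_eq (by ring)
  have hsgn : ((-1 : ℂ)) ^ n ≠ 0 := pow_ne_zero _ (by norm_num)
  have h1a : rising (1 - a) n ≠ 0 := fun h => hd n (by rw [hrefl, h, mul_zero])
  -- For `b = 0` the rewriting `(b)_k / (1+b)_k = b / (b+k)` breaks down at `k = 0`; the series is
  -- just its first term `1`.
  by_cases hb0 : b = 0
  · subst hb0
    have hΓ : Complex.Gamma (1 - c) ≠ 0 :=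
      Complex.Gamma_ne_zero_of_re_pos (by simp; linarith)
    refine (hasSum_ite_eq 0 (1 : ℂ)).of_eq (fun k => ?_) ?_
    · cases k with
      | zero => simp [hyperTerm_eq]
      | succ k => simp [hyperTerm_eq, rising_succ_left]
    · simp [h1a, hΓ]
  have hbn : ¬ IsNonposInt b := by
    rintro ⟨m, hm⟩
    cases m with
    | zero => exact hb0 (by simpa using hm)
    | succ m => exact hb ⟨m, by rw [hm]; push_cast; ring⟩
  have hbk : ∀ k : ℕ, b + k ≠ 0 := fun k h => hbn ⟨k, eq_neg_of_add_eq_zero_left h⟩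
  have h := (hasSum_binCoeff_mul_prod_div n hbn (fun i => a - n + i) hc (by linarith)).mul_left
    (b / rising (a - n) n)
  refine h.of_eq (fun k => ?_) ?_
  · have h1 : rising (a - n) k * rising (a - n + k) n = rising (a - n) n * rising a k := by
      rw [← rising_add, add_comm, rising_add]; congr 2; ring
    have h2 : rising b k * (b + k) = b * rising (1 + b) k := by
      rw [← rising_succ, rising_succ_left, add_comm]
    have h3 : ∏ i ∈ Finset.range n, (a - n + i + k) = rising (a - n + k) n := by
      rw [rising_eq_prod]; exact Finset.prod_congr rfl fun i _ => by ring
    rw [h3, hyperTerm_eq, binCoeff]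
    simp only [Matrix.cons_val]
    have h5 := hd k
    have h6 := hd n
    have h7 := hbk k
    have h8 := he k
    have h9 : (k.factorial : ℂ) ≠ 0 := by exact_mod_cast k.factorial_ne_zero
    field_simp
    linear_combination rising c k * (rising (a - n) n * rising a k) * h2 -
      rising c k * b * rising (1 + b) k * h1
  · have h3 : ∏ i ∈ Finset.range n, (a - n + i - b) = rising (a - n - b) n := by
      rw [rising_eq_prod]; exact Finset.prod_congr rfl fun i _ => by ring
    have h4 : rising (a - n - b) n = (-1) ^ n * rising (1 + b - a) n :=
      rising_eq_of_add_eq (by ring)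
    rw [h3, h4, hrefl, add_comm 1 b, Complex.Gamma_add_one b hb0]
    field_simp

/-- The terms of the Pfaff-Saalschütz sum, cleared of denominators. -/
noncomputable def saalTerm (a b c : ℂ) (n k : ℕ) : ℂ :=
  n.choose k * rising a k * rising b k * rising (c + k) (n - k) * rising (c - a - b) (n - k)

theorem saalTerm_of_lt (a b c : ℂ) {n k : ℕ} (h : n < k) : saalTerm a b c n k = 0 := by
  simp [saalTerm, Nat.choose_eq_zero_of_lt h]

/-- The part of `saalTerm a b c (n + 1) (k + 1)` coming from `n.choose k` in Pascal's rule. -/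
noncomputable def saalShift (a b c : ℂ) (n k : ℕ) : ℂ :=
  n.choose k * rising a (k + 1) * rising b (k + 1) * rising (c + k + 1) (n - k) *
    rising (c - a - b) (n - k)

theorem saalTerm_succ_zero (a b c : ℂ) (n : ℕ) :
    saalTerm a b c (n + 1) 0 = saalTerm a b c n 0 * ((c + n) * (c - a - b + n - (0 : ℕ))) := by
  simp [saalTerm, rising_succ]; ring

theorem saalTerm_succ_succ (a b c : ℂ) {n k : ℕ} (hk : k ≤ n) :
    saalTerm a b c (n + 1) (k + 1) = saalShift a b c n k +
      saalTerm a b c n (k + 1) * ((c + n) * (c - a - b + n - (k + 1 : ℕ))) := by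
  obtain rfl | hlt := hk.eq_or_lt
  · rw [saalTerm_of_lt a b c (Nat.lt_succ_self k)]
    simp [saalTerm, saalShift]
  · obtain ⟨m, rfl⟩ := Nat.exists_eq_add_of_lt hlt
    have h1 : k + m + 1 + 1 - (k + 1) = m + 1 := by omega
    have h2 : k + m + 1 - (k + 1) = m := by omega
    have h3 : k + m + 1 - k = m + 1 := by omega
    simp only [saalTerm, saalShift, h1, h2, h3, Nat.choose_succ_succ, rising_succ _ m]
    push_cast
    rw [show c + (k + 1 : ℂ) = c + k + 1 by ring]
    ring

/-- Up to a difference of consecutive values of `k T_k (c - a - b + n - k)`, with `T_k` the term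
`saalTerm a b c n k`, the shifted part is `T_k` times `k (c + n) + a b`. That factor is what is
needed to complete `(c + n) (c - a - b + n - k)` to `(c - a + n) (c - b + n)`, which no longer
depends on `k`. -/
theorem saalShift_telescope (a b c : ℂ) {n k : ℕ} (hk : k ≤ n) :
    saalShift a b c n k - saalTerm a b c n k * (k * (c + n) + a * b) =
      (k + 1 : ℕ) * saalTerm a b c n (k + 1) * (c - a - b + n - (k + 1 : ℕ)) -
        k * saalTerm a b c n k * (c - a - b + n - k) := by
  obtain rfl | hlt := hk.eq_or_lt
  · rw [saalTerm_of_lt a b c (Nat.lt_succ_self k)]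
    simp [saalTerm, saalShift, rising_succ]
    ring
  · obtain ⟨m, rfl⟩ := Nat.exists_eq_add_of_lt hlt
    have h2 : k + m + 1 - (k + 1) = m := by omega
    have h3 : k + m + 1 - k = m + 1 := by omega
    have h4 : ((k + m + 1).choose (k + 1) : ℂ) * (k + 1) = (k + m + 1).choose k * (m + 1) := by
      have := Nat.choose_succ_right_eq (k + m + 1) k
      rw [h3] at this
      exact_mod_cast this
    have h5 : rising (c + k) (m + 1) = (c + k) * rising (c + k + 1) m := rising_succ_left _ _
    simp only [saalTerm, saalShift, h2, h3, h5, rising_succ]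
    push_cast
    rw [show c + (k + 1 : ℂ) = c + k + 1 by ring]
    linear_combination (-(rising a k * (a + k) * rising b k * (b + k) * rising (c + k + 1) m *
      rising (c - a - b) m * (c - a - b + m))) * h4

theorem sum_saalTerm (a b c : ℂ) (n : ℕ) :
    ∑ k ∈ Finset.range (n + 1), saalTerm a b c n k = rising (c - a) n * rising (c - b) n := by
  induction n with
  | zero => simp [saalTerm]
  | succ n ih =>
    have h1 : ∑ k ∈ Finset.range (n + 2), saalTerm a b c (n + 1) k =
        ∑ k ∈ Finset.range (n + 1), saalShift a b c n k +
        ∑ k ∈ Finset.range (n + 1), saalTerm a b c n k * ((c + n) * (c - a - b + n - k)) := by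
      have h2 : ∑ k ∈ Finset.range (n + 1), saalTerm a b c n k * ((c + n) * (c - a - b + n - k)) =
          ∑ k ∈ Finset.range (n + 2), saalTerm a b c n k * ((c + n) * (c - a - b + n - k)) := by
        rw [Finset.sum_range_succ _ (n + 1), saalTerm_of_lt a b c (Nat.lt_succ_self n)]
        simp
      rw [h2, Finset.sum_range_succ', Finset.sum_range_succ' _ (n + 1), saalTerm_succ_zero,
        ← add_assoc, ← Finset.sum_add_distrib]
      congr 1
      exact Finset.sum_congr rfl fun k hk =>
        saalTerm_succ_succ a b c (Nat.lt_succ_iff.1 (Finset.mem_range.1 hk))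
    -- Both boundary terms vanish: the factor `k` at the lower end, `saalTerm` itself at `k = n +
    -- 1`.
    have h3 := Finset.sum_range_sub
      (fun k : ℕ => k * saalTerm a b c n k * (c - a - b + n - k)) (n + 1)
    rw [saalTerm_of_lt a b c (Nat.lt_succ_self n), ← Finset.sum_congr rfl fun k hk =>
      saalShift_telescope a b c (Nat.lt_succ_iff.1 (Finset.mem_range.1 hk))] at h3
    simp only [Nat.cast_zero, mul_zero, zero_mul, sub_zero, Finset.sum_sub_distrib] at h3
    rw [h1, sub_eq_zero.1 h3, ← Finset.sum_add_distrib, rising_succ, rising_succ]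
    calc _ = ∑ k ∈ Finset.range (n + 1), saalTerm a b c n k * ((c - a + n) * (c - b + n)) :=
          Finset.sum_congr rfl fun k _ => by ring
      _ = _ := by rw [← Finset.sum_mul, ih]; ring

theorem rising_neg_natCast (n k : ℕ) :
    rising (-(n : ℂ)) k = (-1) ^ k * k.factorial * n.choose k := by
  induction k with
  | zero => simp
  | succ k ih =>
    rw [rising_succ, ih, Nat.factorial_succ]
    have h : (n.choose (k + 1) : ℂ) * (k + 1) = n.choose k * (n - k) := by
      rcases le_or_gt k n with hk | hk
      · rw [← Nat.cast_sub hk]; exact_mod_cast Nat.choose_succ_right_eq n k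
      · simp [Nat.choose_eq_zero_of_lt hk, Nat.choose_eq_zero_of_lt (Nat.lt_succ_of_lt hk)]
    push_cast
    linear_combination (-(-1 : ℂ) ^ (k + 1) * k.factorial) * h

/-- The Pfaff-Saalschütz sum. -/
theorem hasSum_hyperTerm_saalschuetz (n : ℕ) {a b c : ℂ} (hc : ¬ IsNonposInt c)
    (he : ¬ IsNonposInt (1 + a + b - c - n)) :
    HasSum (hyperTerm ![-(n : ℂ), a, b, c, 1 + a + b - c - n])
      (rising (c - a) n * rising (c - b) n / (rising c n * rising (c - a - b) n)) := by
  have hsgn : ∀ k, ((-1 : ℂ)) ^ k ≠ 0 := fun k => pow_ne_zero _ (by norm_num)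
  have hrefl : rising (1 + a + b - c - n) n = (-1) ^ n * rising (c - a - b) n :=
    rising_eq_of_add_eq (by ring)
  have hf : rising (c - a - b) n ≠ 0 := fun h => rising_ne_zero n he (by rw [hrefl, h, mul_zero])
  have hsum : HasSum (hyperTerm ![-(n : ℂ), a, b, c, 1 + a + b - c - n])
      (∑ k ∈ Finset.range (n + 1), hyperTerm ![-(n : ℂ), a, b, c, 1 + a + b - c - n] k) :=
    hasSum_sum_of_ne_finset_zero (fun k hk => by
      have : n < k := by simpa using hk
      simp [hyperTerm_eq, rising_neg_natCast_eq_zero this])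
  refine hsum.of_eq (fun _ => rfl) ?_
  rw [← sum_saalTerm, Finset.sum_div]
  refine Finset.sum_congr rfl fun k hk => ?_
  obtain ⟨m, rfl⟩ := Nat.exists_eq_add_of_le (Nat.lt_succ_iff.1 (Finset.mem_range.1 hk))
  have h1 : rising c (k + m) = rising c k * rising (c + k) m := rising_add _ _ _
  -- The last `k` factors of `(c - a - b)_n`, reversed, are up to sign the rising factorial of the
  -- second lower parameter.
  have h2 : rising (c - a - b) (k + m) =
      rising (c - a - b) m * ((-1) ^ k * rising (1 + a + b - c - (k + m : ℕ)) k) := by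
    rw [add_comm k m, rising_add, rising_eq_of_add_eq (y := 1 + a + b - c - (m + k : ℕ))
      (z := c - a - b + m) (by push_cast; ring), ← mul_assoc ((-1) ^ k), ← mul_pow]
    simp
  have h3 := rising_ne_zero (k + m) hc
  rw [h1] at h3
  rw [h2] at hf
  have h4 : (k.factorial : ℂ) ≠ 0 := by exact_mod_cast k.factorial_ne_zero
  obtain ⟨h5, h6⟩ := mul_ne_zero_iff.1 h3
  obtain ⟨h7, h8⟩ := mul_ne_zero_iff.1 hf
  obtain ⟨-, h9⟩ := mul_ne_zero_iff.1 h8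
  have hs2 : ((-1 : ℂ)) ^ k * (-1) ^ k = 1 := by rw [← mul_pow]; simp
  rw [hyperTerm_eq, saalTerm, h1, h2]
  simp only [Matrix.cons_val, rising_neg_natCast, Nat.add_sub_cancel_left]
  have h10 := hsgn k
  field_simp
  linear_combination (-((k + m).choose k * rising a k * rising b k)) * hs2

/-! ### Values of gamma quotients -/

/-- A disc of radius `1/2` contains at most one integer, since distinct integers are at distance at
least `1`. -/
theorem eventually_nhdsNE_not_isNonposInt (z : ℂ) : ∀ᶠ w in 𝓝[≠] z, ¬ IsNonposInt w := by
  have hball : Metric.ball z (1 / 2) ∈ 𝓝 z := Metric.ball_mem_nhds z (by norm_num)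
  by_cases h : ∃ w₀ ∈ Metric.ball z (1 / 2), w₀ ≠ z ∧ IsNonposInt w₀
  · obtain ⟨w₀, hw₀, hne, m, hm⟩ := h
    filter_upwards [mem_nhdsWithin_of_mem_nhds hball,
      mem_nhdsWithin_of_mem_nhds (isOpen_ne.mem_nhds hne.symm)] with w hw hww₀
    rintro ⟨k, hk⟩
    apply hww₀
    have hd : dist w w₀ < 1 := by
      have := dist_triangle_right w w₀ z
      rw [Metric.mem_ball] at hw hw₀
      linarith
    rw [hk, hm, dist_neg_neg, Complex.dist_eq, ← Complex.ofReal_natCast, ← Complex.ofReal_natCast,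
      ← Complex.ofReal_sub, Complex.norm_real, Real.norm_eq_abs] at hd
    have hd' : |(k : ℤ) - m| < 1 := by exact_mod_cast hd
    have : (k : ℤ) = m := sub_eq_zero.1 (Int.abs_lt_one_iff.1 hd')
    rw [hk, hm, Nat.cast_inj.1 this]
  · push Not at h
    filter_upwards [mem_nhdsWithin_of_mem_nhds hball, self_mem_nhdsWithin] with w hw hne
    exact h w hw hne

theorem eventually_nhds_not_isNonposInt {z : ℂ} (hz : ¬ IsNonposInt z) :
    ∀ᶠ w in 𝓝 z, ¬ IsNonposInt w := by
  filter_upwards [eventually_nhdsWithin_iff.1 (eventually_nhdsNE_not_isNonposInt z)] with w hw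
  by_cases h : w = z
  · rwa [h]
  · exact hw h

theorem eventually_not_isNonposInt_line (z : ℂ) {m : ℂ} (hm : m ≠ 0) :
    ∀ᶠ t in 𝓝[≠] (0 : ℂ), ¬ IsNonposInt (z + m * t) := by
  have h : Tendsto (fun t : ℂ => z + m * t) (𝓝[≠] 0) (𝓝[≠] z) := by
    refine tendsto_nhdsWithin_iff.2 ⟨?_, ?_⟩
    · have : Continuous fun t : ℂ => z + m * t := by fun_prop
      exact (this.tendsto' 0 z (by simp)).mono_left nhdsWithin_le_nhds
    · filter_upwards [self_mem_nhdsWithin] with t ht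
      simpa [hm] using ht
  exact h.eventually (eventually_nhdsNE_not_isNonposInt z)

theorem mem_closure_of_line {X : Type} [TopologicalSpace X] {S : Set X} {p : X} (γ : ℂ → X)
    (hγ : Continuous γ) (h0 : γ 0 = p) (hS : ∀ᶠ t in 𝓝[≠] (0 : ℂ), γ t ∈ S) : p ∈ closure S :=
  mem_closure_of_tendsto ((hγ.tendsto' 0 p h0).mono_left nhdsWithin_le_nhds) hS

/-- Removable singularities are handled by exhibiting a function `G`, continuous at the point, that
agrees with the quotient at regular points; below, `G` has the ratios `Γ(z + n) / Γ(z)` replaced by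
rising factorials. -/
theorem IsGammaQuotientValue.of_continuousAt {X : Type} [TopologicalSpace X] {S : Set X}
    {num den : List (X → ℂ)} {p : X} {w : ℂ} (G : X → ℂ) (hG : ContinuousAt G p) (hw : G p = w)
    (heq : ∀ q ∈ S ∩ regularSet num, gammaQuotient num den q = G q)
    (hp : p ∈ closure (S ∩ regularSet num)) : IsGammaQuotientValue S num den p w := by
  refine ⟨hp, ?_⟩
  rw [← hw]
  refine (hG.tendsto.mono_left nhdsWithin_le_nhds).congr' ?_
  filter_upwards [self_mem_nhdsWithin] with q hq using (heq q hq).symm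

theorem continuous_inv_Gamma : Continuous fun z : ℂ => (Complex.Gamma z)⁻¹ :=
  Complex.differentiable_one_div_Gamma.continuous

theorem continuousAt_Gamma' {z : ℂ} (hz : ¬ IsNonposInt z) : ContinuousAt Complex.Gamma z :=
  Complex.continuousAt_Gamma z fun m h => hz ⟨m, h⟩

theorem Gamma_add_nat_mul_inv {z : ℂ} {n : ℕ} (h : ¬ IsNonposInt (z + n)) :
    Complex.Gamma (z + n) * (Complex.Gamma z)⁻¹ = rising z n := by
  rw [inv_Gamma_eq z n]
  field_simp [Gamma_ne_zero' h]

theorem Gamma_mul_inv_add_nat {z : ℂ} (h : ¬ IsNonposInt z) (n : ℕ) :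
    Complex.Gamma z * (Complex.Gamma (z + n))⁻¹ = (rising z n)⁻¹ := by
  rw [Gamma_add_nat h, mul_inv, mul_comm, mul_assoc, inv_mul_cancel₀ (Gamma_ne_zero' h), mul_one]

/-- The first identity, with its gamma quotient. -/
theorem saalschuetz_isGammaQuotientValue (n : ℕ) (a b c : ℂ) (hc : ¬ IsNonposInt c)
    (he : ¬ IsNonposInt (1 + a + b - c - n)) :
    ∃ w : ℂ, HasSum (hyperTerm ![-(n : ℂ), a, b, c, 1 + a + b - c - n]) w ∧
      IsGammaQuotientValue (X := ℂ × ℂ × ℂ) Set.univ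
        [fun q => q.2.2 - q.1 + n, fun q => q.2.2 - q.2.1 + n, fun q => q.2.2,
          fun q => q.2.2 - q.1 - q.2.1]
        [fun q => q.2.2 - q.1, fun q => q.2.2 - q.2.1, fun q => q.2.2 + n,
          fun q => q.2.2 - q.1 - q.2.1 + n]
        (a, b, c) w := by
  refine ⟨_, hasSum_hyperTerm_saalschuetz n hc he, ?_⟩
  have hf : rising (c - a - b) n ≠ 0 := fun h => rising_ne_zero n he (by
    rw [rising_eq_of_add_eq (z := c - a - b) (by ring), h, mul_zero])
  have hr := continuous_rising n
  refine IsGammaQuotientValue.of_continuousAt (fun q : ℂ × ℂ × ℂ =>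
    rising (q.2.2 - q.1) n * rising (q.2.2 - q.2.1) n /
      (rising q.2.2 n * rising (q.2.2 - q.1 - q.2.1) n)) ?_ rfl ?_ ?_
  · refine ContinuousAt.div ?_ ?_ (mul_ne_zero (rising_ne_zero n hc) hf)
    · exact Continuous.continuousAt (by fun_prop)
    · exact Continuous.continuousAt (by fun_prop)
  · rintro ⟨a, b, c⟩ ⟨-, hq⟩
    simp only [regularSet, List.mem_cons, List.not_mem_nil, or_false, forall_eq_or_imp, forall_eq,
      Set.mem_ofPred_eq] at hq
    obtain ⟨h1, h2, h3, h4⟩ := hq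
    simp only [gammaQuotient, List.map_cons, List.map_nil, List.prod_cons, List.prod_nil, mul_one]
    rw [← Gamma_add_nat_mul_inv h1, ← Gamma_add_nat_mul_inv h2, div_eq_mul_inv _ (rising c n * _),
      mul_inv (rising c n), ← Gamma_mul_inv_add_nat h3, ← Gamma_mul_inv_add_nat h4]
    simp only [div_eq_mul_inv, mul_inv]
    ring
  · refine mem_closure_of_line (fun t => (a, b, c + t)) (by fun_prop) (by simp) ?_
    have h := fun z => eventually_not_isNonposInt_line z one_ne_zero
    filter_upwards [h (c - a + n), h (c - b + n), h c, h (c - a - b)] with t h1 h2 h3 h4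
    simp only [regularSet, List.mem_cons, List.not_mem_nil, or_false, forall_eq_or_imp, forall_eq,
      Set.mem_ofPred_eq, Set.univ_inter]
    rw [one_mul] at h1 h2 h3 h4
    refine ⟨?_, ?_, h3, ?_⟩
    · convert h1 using 2; ring
    · convert h2 using 2; ring
    · convert h4 using 2; ring

/-- The second identity, with its gamma quotient. -/
theorem shifted_isGammaQuotientValue {n : ℕ} (hn : 1 ≤ n) (a b c : ℂ)
    (ha : ¬ IsNonposInt (a - n)) (hb : ¬ IsNonposInt (1 + b))
    (hs : 0 < ((a - n) + (1 + b) - a - b - c).re) :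
    ∃ w : ℂ, HasSum (hyperTerm ![a, b, c, a - n, 1 + b]) w ∧
      IsGammaQuotientValue (X := ℂ × ℂ × ℂ) Set.univ
        [fun q => 1 + q.2.1 - q.1 + n, fun q => 1 - q.1, fun q => 1 - q.2.2, fun q => 1 + q.2.1]
        [fun q => 1 + q.2.1 - q.1, fun q => 1 - q.1 + n, fun q => 1 + q.2.1 - q.2.2]
        (a, b, c) w := by
  have hc : c.re < 1 - n := by
    have h : (a - n) + (1 + b) - a - b - c = 1 - n - c := by ring
    rw [h] at hs; simp at hs; linarith
  have hn' : (1 : ℝ) ≤ n := by exact_mod_cast hn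
  refine ⟨_, hasSum_hyperTerm_shifted hn ha hb hc, ?_⟩
  have h1a : rising (1 - a) n ≠ 0 := fun h => rising_ne_zero n ha (by
    rw [rising_eq_of_add_eq (z := 1 - a) (by ring), h, mul_zero])
  have h1c : ¬ IsNonposInt (1 - c) := by
    rintro ⟨m, hm⟩
    have := congrArg Complex.re hm
    simp at this
    have hm0 : (0 : ℝ) ≤ m := m.cast_nonneg
    linarith
  have hr := continuous_rising n
  have hi := continuous_inv_Gamma
  refine IsGammaQuotientValue.of_continuousAt (fun q : ℂ × ℂ × ℂ =>
    rising (1 + q.2.1 - q.1) n / rising (1 - q.1) n *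
      (Complex.Gamma (1 + q.2.1) * Complex.Gamma (1 - q.2.2) *
        (Complex.Gamma (1 + q.2.1 - q.2.2))⁻¹)) ?_ (by simp [div_eq_mul_inv]) ?_ ?_
  · refine ContinuousAt.mul (ContinuousAt.div ?_ ?_ h1a)
      (ContinuousAt.mul (ContinuousAt.mul ?_ ?_) ?_)
    · exact Continuous.continuousAt (by fun_prop)
    · exact Continuous.continuousAt (by fun_prop)
    · exact ContinuousAt.comp (f := fun q : ℂ × ℂ × ℂ => 1 + q.2.1) (continuousAt_Gamma' hb)
        (Continuous.continuousAt (by fun_prop))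
    · exact ContinuousAt.comp (f := fun q : ℂ × ℂ × ℂ => 1 - q.2.2) (continuousAt_Gamma' h1c)
        (Continuous.continuousAt (by fun_prop))
    · exact Continuous.continuousAt (hi.comp (by fun_prop))
  · rintro ⟨a, b, c⟩ ⟨-, hq⟩
    simp only [regularSet, List.mem_cons, List.not_mem_nil, or_false, forall_eq_or_imp, forall_eq,
      Set.mem_ofPred_eq] at hq
    obtain ⟨h1, h2, h3, h4⟩ := hq
    simp only [gammaQuotient, List.map_cons, List.map_nil, List.prod_cons, List.prod_nil, mul_one]
    rw [← Gamma_add_nat_mul_inv h1, div_eq_mul_inv _ (rising (1 - a) n),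
      ← Gamma_mul_inv_add_nat h2]
    simp only [div_eq_mul_inv, mul_inv]
    ring
  -- The slopes make all four numerator arguments vary; moving `a` and `b` at equal speed would
  -- freeze `1 + b - a + n`.
  · refine mem_closure_of_line (fun t => (a + t, b + 2 * t, c + t)) (by fun_prop) (by simp) ?_
    have h := fun z => eventually_not_isNonposInt_line z one_ne_zero
    have h' := fun z => eventually_not_isNonposInt_line z (neg_ne_zero.2 one_ne_zero)
    filter_upwards [h (1 + b - a + n), h' (1 - a), h' (1 - c),
      eventually_not_isNonposInt_line (1 + b) two_ne_zero] with t h1 h2 h3 h4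
    simp only [regularSet, List.mem_cons, List.not_mem_nil, or_false, forall_eq_or_imp, forall_eq,
      Set.mem_ofPred_eq, Set.univ_inter]
    refine ⟨?_, ?_, ?_, ?_⟩
    · convert h1 using 2; ring
    · convert h2 using 2; ring
    · convert h3 using 2; ring
    · convert h4 using 2; ring

/-! ### Normalized values -/

theorem saalschuetz_normalized (n : ℕ) {a b c e : ℂ} (hc : ¬ IsNonposInt c)
    (he : ¬ IsNonposInt e) (h : e = 1 + a + b - c - n) :
    rising (c - a) n * rising (c - b) n / (rising c n * rising (c - a - b) n) /
        (Complex.Gamma c * Complex.Gamma e * Complex.Gamma 1) =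
      rising (c - a) n * rising (e - a) n * (Complex.Gamma (c + n))⁻¹ *
        (Complex.Gamma (e + n))⁻¹ := by
  have h1 : rising (c - b) n = (-1) ^ n * rising (e - a) n :=
    rising_eq_of_add_eq (by rw [h]; ring)
  have h2 : rising (c - a - b) n = (-1) ^ n * rising e n :=
    rising_eq_of_add_eq (by rw [h]; ring)
  have h3 : ((-1 : ℂ)) ^ n ≠ 0 := pow_ne_zero _ (by norm_num)
  have h4 := rising_ne_zero n hc
  have h5 := rising_ne_zero n he
  have h6 := Gamma_ne_zero' hc
  have h7 := Gamma_ne_zero' he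
  rw [h1, h2, Gamma_add_nat hc, Gamma_add_nat he, Complex.Gamma_one]
  field_simp

/-- As in the Saalschütz case, the normalization leaves only two rising factorials and two values of
`1/Γ`; in symmetric coordinates the two results coincide. -/
theorem shifted_normalized (n : ℕ) {a b c d e s : ℂ} (hd : ¬ IsNonposInt d)
    (he : ¬ IsNonposInt e) (hs : ¬ IsNonposInt s) (hda : d = a - n) (heb : e = 1 + b)
    (hsc : s = 1 - n - c) :
    rising (1 + b - a) n / rising (1 - a) n *
        (Complex.Gamma (1 + b) * Complex.Gamma (1 - c) / Complex.Gamma (1 + b - c)) /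
        (Complex.Gamma d * Complex.Gamma e * Complex.Gamma s) =
      rising (1 + b - a) n * rising c n * (Complex.Gamma a)⁻¹ *
        (Complex.Gamma (1 + b - c))⁻¹ := by
  have h3 : ((-1 : ℂ)) ^ n ≠ 0 := pow_ne_zero _ (by norm_num)
  have h1 : rising d n = (-1) ^ n * rising (1 - a) n := rising_eq_of_add_eq (by rw [hda]; ring)
  have h2 : rising s n = (-1) ^ n * rising c n := rising_eq_of_add_eq (by rw [hsc]; ring)
  have h4 : Complex.Gamma a = rising d n * Complex.Gamma d := by
    rw [← Gamma_add_nat hd, hda]; ring_nf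
  have h5 : Complex.Gamma (1 - c) = rising s n * Complex.Gamma s := by
    rw [← Gamma_add_nat hs, hsc]; ring_nf
  have h6 := rising_ne_zero n hd
  rw [h1] at h6
  obtain ⟨-, h7⟩ := mul_ne_zero_iff.1 h6
  have h8 := Gamma_ne_zero' hd
  have h9 := Gamma_ne_zero' he
  have h10 := Gamma_ne_zero' hs
  have h11 : (((-1 : ℂ)) ^ n) ^ 2 = 1 := by rw [← pow_mul, mul_comm, pow_mul]; simp
  rw [h4, h5, ← heb, h1, h2]
  field_simp
  rw [h11, mul_one]

/-! ### The planes of the orbit -/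

theorem fromSymmetric_apply (w : Params) : fromSymmetric w =
    ![w 0 + w 3 + w 4, w 1 + w 3 + w 4, w 2 + w 3 + w 4,
      w 0 + w 1 + w 2 + 2 * w 3 + w 4, w 0 + w 1 + w 2 + w 3 + 2 * w 4] := by
  change Matrix.vecMul w thomaeA = _
  ext j
  fin_cases j <;> simp [thomaeA, Matrix.vecMul, dotProduct, Fin.sum_univ_five] <;> ring

theorem parametricExcess_fromSymmetric (w : Params) :
    parametricExcess (fromSymmetric w) = w 0 + w 1 + w 2 := by
  rw [fromSymmetric_apply]
  simp [parametricExcess]; ring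

theorem thomaeMap_fromSymmetric (τ : Equiv.Perm (Fin 5)) (w : Params) :
    thomaeMap τ (fromSymmetric w) = fromSymmetric (w ∘ τ) := by
  simp [thomaeMap, LinearEquiv.funCongrLeft_apply, LinearMap.funLeft, Function.comp_def]

/-- The permutations that act separately on the upper and on the lower parameters. -/
def IsSeparate (σ : Equiv.Perm (Fin 5)) : Prop := ∀ i, σ i < 3 ↔ i < 3

theorem IsSeparate.cases : ∀ σ : Equiv.Perm (Fin 5), (∀ i, σ i < 3 ↔ i < 3) →
    ((σ 0 = 0 ∧ σ 1 = 1 ∧ σ 2 = 2) ∨ (σ 0 = 0 ∧ σ 1 = 2 ∧ σ 2 = 1) ∨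
      (σ 0 = 1 ∧ σ 1 = 0 ∧ σ 2 = 2) ∨ (σ 0 = 1 ∧ σ 1 = 2 ∧ σ 2 = 0) ∨
      (σ 0 = 2 ∧ σ 1 = 0 ∧ σ 2 = 1) ∨ (σ 0 = 2 ∧ σ 1 = 1 ∧ σ 2 = 0)) ∧
    ((σ 3 = 3 ∧ σ 4 = 4) ∨ (σ 3 = 4 ∧ σ 4 = 3)) := by
  decide +kernel

/-- Representatives of the double cosets that describe the orbit. -/
def rep : Fin 5 → Equiv.Perm (Fin 5) :=
  ![1, ⟨![1, 3, 0, 4, 2], ![2, 0, 4, 1, 3], by decide, by decide⟩,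
    ⟨![0, 3, 4, 1, 2], ![0, 3, 4, 1, 2], by decide, by decide⟩,
    ⟨![3, 1, 2, 0, 4], ![3, 1, 2, 0, 4], by decide, by decide⟩,
    ⟨![1, 3, 4, 0, 2], ![3, 0, 4, 1, 2], by decide, by decide⟩]

/-- The permutations of the symmetric coordinates that preserve the base plane. -/
def planeSwaps : List (Equiv.Perm (Fin 5)) :=
  [1, Equiv.swap 1 2, Equiv.swap 3 4, Equiv.swap 1 2 * Equiv.swap 3 4]

/-- The five cases are: index `0` in an upper slot, with `{1,2}` filling the other upper slots (`rep
0`), split between upper and lower (`rep 1`), or filling the lower slots (`rep 2`); or index `0` in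
a lower slot, next to one of `{3,4}` (`rep 3`) or one of `{1,2}` (`rep 4`). -/
theorem exists_rep : ∀ τ : Equiv.Perm (Fin 5), ∃ i : Fin 5,
    ∃ h ∈ planeSwaps,
      ∀ j, (rep i).symm (h.symm (τ j)) < 3 ↔ j < 3 := by
  decide +kernel

theorem exists_eq_mul_rep_mul (τ : Equiv.Perm (Fin 5)) : ∃ i : Fin 5,
    ∃ h ∈ planeSwaps,
      ∃ k, IsSeparate k ∧ τ = h * rep i * k := by
  obtain ⟨i, h, hh, hk⟩ := exists_rep τ
  exact ⟨i, h, hh, (rep i)⁻¹ * h⁻¹ * τ, hk, by group⟩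

/-- Each upper parameter is its own coordinate plus `u + v`, and each lower one is its own
coordinate plus the sum of all five, so separate permutations look the same in both coordinate
systems. -/
theorem fromSymmetric_comp {k : Equiv.Perm (Fin 5)} (hk : IsSeparate k) (w : Params) :
    fromSymmetric (w ∘ k) = fromSymmetric w ∘ k := by
  rw [fromSymmetric_apply, fromSymmetric_apply]
  obtain ⟨h012, h34⟩ := IsSeparate.cases k hk
  ext j
  rcases h012 with ⟨h0, h1, h2⟩ | ⟨h0, h1, h2⟩ | ⟨h0, h1, h2⟩ | ⟨h0, h1, h2⟩ | ⟨h0, h1, h2⟩ |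
    ⟨h0, h1, h2⟩ <;> rcases h34 with ⟨h3, h4⟩ | ⟨h3, h4⟩ <;> fin_cases j <;>
    simp [h0, h1, h2, h3, h4] <;> ring

theorem symmetric_functions_comp {k : Equiv.Perm (Fin 5)} (hk : IsSeparate k) (f : Fin 5 → ℂ) :
    f (k 0) * f (k 1) * f (k 2) = f 0 * f 1 * f 2 ∧ f (k 3) * f (k 4) = f 3 * f 4 ∧
      f (k 0) + f (k 1) + f (k 2) = f 0 + f 1 + f 2 ∧ f (k 3) + f (k 4) = f 3 + f 4 := by
  obtain ⟨h012, h34⟩ := IsSeparate.cases k hk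
  constructor
  · rcases h012 with ⟨h0, h1, h2⟩ | ⟨h0, h1, h2⟩ | ⟨h0, h1, h2⟩ | ⟨h0, h1, h2⟩ | ⟨h0, h1, h2⟩ |
      ⟨h0, h1, h2⟩ <;> rw [h0, h1, h2] <;> ring
  constructor
  · rcases h34 with ⟨h3, h4⟩ | ⟨h3, h4⟩ <;> rw [h3, h4]
    ring
  constructor
  · rcases h012 with ⟨h0, h1, h2⟩ | ⟨h0, h1, h2⟩ | ⟨h0, h1, h2⟩ | ⟨h0, h1, h2⟩ | ⟨h0, h1, h2⟩ |
      ⟨h0, h1, h2⟩ <;> rw [h0, h1, h2] <;> ring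
  · rcases h34 with ⟨h3, h4⟩ | ⟨h3, h4⟩ <;> rw [h3, h4]
    ring

theorem hyperTerm_comp {k : Equiv.Perm (Fin 5)} (hk : IsSeparate k) (p : Params) :
    hyperTerm (p ∘ k) = hyperTerm p := by
  ext m
  obtain ⟨h1, h2, -⟩ := symmetric_functions_comp hk fun i => rising (p i) m
  simp only [hyperTerm_eq, Function.comp_apply, h1, h2]

theorem parametricExcess_comp {k : Equiv.Perm (Fin 5)} (hk : IsSeparate k) (p : Params) :
    parametricExcess (p ∘ k) = parametricExcess p := by
  obtain ⟨-, -, h1, h2⟩ := symmetric_functions_comp hk p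
  simp only [parametricExcess, Function.comp_apply]
  linear_combination h2 - h1

theorem convergentParams_comp {k : Equiv.Perm (Fin 5)} (hk : IsSeparate k) (p : Params) :
    ConvergentParams (p ∘ k) ↔ ConvergentParams p := by
  rw [ConvergentParams, parametricExcess_comp hk, ConvergentParams]
  obtain ⟨-, h34⟩ := IsSeparate.cases k hk
  rcases h34 with ⟨h3, h4⟩ | ⟨h3, h4⟩ <;> simp only [Function.comp_apply, h3, h4] <;> tauto

theorem not_isNonposInt_of_re_pos {z : ℂ} (hz : 0 < z.re) : ¬ IsNonposInt z := by
  rintro ⟨m, rfl⟩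
  have : (0 : ℝ) ≤ m := m.cast_nonneg
  simp at hz
  linarith

/-! ### The normalized sum on the planes -/

/-- The base plane of the orbit in the symmetric coordinates. -/
def symPlane (n : ℕ) : Set Params := {w | w 0 + w 3 + w 4 = -(n : ℂ) ∧ w 0 + w 1 + w 2 = 1}

/-- The normalized sum on `symPlane n`. -/
noncomputable def normValue (n : ℕ) (w : Params) : ℂ :=
  rising (w 0 + w 2 + w 3) n * rising (w 0 + w 2 + w 4) n *
    (Complex.Gamma (w 1 + w 2 + w 3))⁻¹ * (Complex.Gamma (w 1 + w 2 + w 4))⁻¹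

/-- Swapping `u, v` only exchanges factors. Swapping `y, z` is a reflection, as `(x + y + u) + (x +
z + v) = 1 - n` on the plane; it occurs twice, so the signs cancel. -/
theorem symPlane_normValue_comp {n : ℕ} {w : Params} (hw : w ∈ symPlane n)
    {h : Equiv.Perm (Fin 5)}
    (hh : h ∈ planeSwaps) :
    w ∘ h ∈ symPlane n ∧ normValue n (w ∘ h) = normValue n w := by
  obtain ⟨h1, h2⟩ := hw
  have hs : (((-1 : ℂ)) ^ n) * (-1) ^ n = 1 := by rw [← mul_pow]; simp
  have e1 : rising (w 0 + w 1 + w 3) n = (-1) ^ n * rising (w 0 + w 2 + w 4) n :=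
    rising_eq_of_add_eq (by linear_combination h1 + h2)
  have e2 : rising (w 0 + w 1 + w 4) n = (-1) ^ n * rising (w 0 + w 2 + w 3) n :=
    rising_eq_of_add_eq (by linear_combination h1 + h2)
  have e3 : w 2 + w 1 + w 3 = w 1 + w 2 + w 3 := by ring
  have e4 : w 2 + w 1 + w 4 = w 1 + w 2 + w 4 := by ring
  simp only [planeSwaps, List.mem_cons, List.not_mem_nil, or_false] at hh
  rcases hh with rfl | rfl | rfl | rfl
  · exact ⟨⟨h1, h2⟩, rfl⟩
  · refine ⟨⟨?_, ?_⟩, ?_⟩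
    · simpa [Equiv.swap_apply_def] using h1
    · simp [Equiv.swap_apply_def]; linear_combination h2
    · simp only [normValue, Function.comp_apply, Equiv.swap_apply_def]
      simp only [Fin.reduceEq, if_true, if_false, e1, e2, e3, e4]
      linear_combination (rising (w 0 + w 2 + w 3) n * rising (w 0 + w 2 + w 4) n *
        (Complex.Gamma (w 1 + w 2 + w 3))⁻¹ * (Complex.Gamma (w 1 + w 2 + w 4))⁻¹) * hs
  · refine ⟨⟨?_, ?_⟩, ?_⟩
    · simp [Equiv.swap_apply_def]; linear_combination h1
    · simpa [Equiv.swap_apply_def] using h2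
    · simp only [normValue, Function.comp_apply, Equiv.swap_apply_def]
      simp only [Fin.reduceEq, if_true, if_false]
      ring
  · refine ⟨⟨?_, ?_⟩, ?_⟩
    · simp [Equiv.swap_apply_def]; linear_combination h1
    · simp [Equiv.swap_apply_def]; linear_combination h2
    · simp only [normValue, Function.comp_apply, Equiv.swap_apply_def, Equiv.Perm.mul_apply]
      simp only [Fin.reduceEq, if_true, if_false, e1, e2, e3, e4]
      linear_combination (rising (w 0 + w 2 + w 3) n * rising (w 0 + w 2 + w 4) n *
        (Complex.Gamma (w 1 + w 2 + w 3))⁻¹ * (Complex.Gamma (w 1 + w 2 + w 4))⁻¹) * hs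

/-- `F` is the sum of the series at `q`, and its normalization is `N`. -/
def HasNormalizedSum (q : Params) (N : ℂ) : Prop :=
  ∃ F : ℂ, HasSum (hyperTerm q) F ∧
    F / (Complex.Gamma (q 3) * Complex.Gamma (q 4) * Complex.Gamma (parametricExcess q)) = N

theorem hasNormalizedSum_comp {k : Equiv.Perm (Fin 5)} (hk : IsSeparate k) (q : Params) (N : ℂ) :
    HasNormalizedSum (q ∘ k) N ↔ HasNormalizedSum q N := by
  obtain ⟨-, h, -⟩ := symmetric_functions_comp hk fun i => Complex.Gamma (q i)
  rw [HasNormalizedSum, hyperTerm_comp hk, parametricExcess_comp hk, Function.comp_apply,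
    Function.comp_apply, h]
  rfl

theorem hasNormalizedSum_rep_zero {n : ℕ} {w : Params} (hw : w ∈ symPlane n)
    (hq : ConvergentParams (fromSymmetric w)) :
    HasNormalizedSum (fromSymmetric w) (normValue n w) := by
  obtain ⟨h1, h2⟩ := hw
  obtain ⟨hd, he, -⟩ := hq
  set q := fromSymmetric w with hqw
  rw [fromSymmetric_apply] at hqw
  have q0 : q 0 = -(n : ℂ) := by rw [hqw]; simpa using h1
  have hs : parametricExcess q = 1 := by
    rw [hqw]; simp [parametricExcess]; linear_combination h2
  have q4 : q 4 = 1 + q 1 + q 2 - q 3 - n := by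
    rw [parametricExcess, q0] at hs; linear_combination hs
  have hq : q = ![-(n : ℂ), q 1, q 2, q 3, 1 + q 1 + q 2 - q 3 - n] := by
    ext j; fin_cases j <;> simp [q0, q4]
  have hsum := hasSum_hyperTerm_saalschuetz n (a := q 1) (b := q 2) hd (q4 ▸ he)
  rw [← hq] at hsum
  refine ⟨_, hsum, ?_⟩
  rw [hs, saalschuetz_normalized n hd he q4, normValue]
  have e1 : q 3 - q 1 = w 0 + w 2 + w 3 := by rw [hqw]; simp; ring
  have e2 : q 4 - q 1 = w 0 + w 2 + w 4 := by rw [hqw]; simp; ring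
  have e3 : q 3 + n = w 1 + w 2 + w 3 := by rw [hqw]; simp; linear_combination h1
  have e4 : q 4 + n = w 1 + w 2 + w 4 := by rw [hqw]; simp; linear_combination h1
  rw [e1, e2, e3, e4]

theorem hasNormalizedSum_rep_one {n : ℕ} (hn : 1 ≤ n) {w : Params} (hw : w ∈ symPlane n)
    (hq : ConvergentParams (fromSymmetric (w ∘ rep 1))) :
    HasNormalizedSum (fromSymmetric (w ∘ rep 1)) (normValue n w) := by
  obtain ⟨h1, h2⟩ := hw
  obtain ⟨hd, he, hs⟩ := hq
  set q := fromSymmetric (w ∘ rep 1) with hqw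
  rw [fromSymmetric_apply] at hqw
  simp [rep] at hqw
  have q3 : q 3 = q 0 - n := by rw [hqw]; simp; linear_combination h1
  have q4 : q 4 = 1 + q 1 := by rw [hqw]; simp; linear_combination h2
  have hsq : parametricExcess q = 1 - n - q 2 := by rw [parametricExcess, q3, q4]; ring
  have hq : q = ![q 0, q 1, q 2, q 0 - n, 1 + q 1] := by
    ext j; fin_cases j <;> simp [q3, q4]
  have hsum := hasSum_hyperTerm_shifted hn (a := q 0) (b := q 1) (c := q 2) (q3 ▸ hd) (q4 ▸ he)
    (by rw [hsq] at hs; simp at hs; linarith)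
  rw [← hq] at hsum
  refine ⟨_, hsum, ?_⟩
  rw [shifted_normalized n hd he (not_isNonposInt_of_re_pos hs) q3 q4 hsq, normValue]
  have e1 : 1 + q 1 - q 0 = w 0 + w 2 + w 3 := by rw [← q4, hqw]; simp; ring
  have e2 : q 2 = w 0 + w 2 + w 4 := by rw [hqw]; simp; ring
  have e3 : q 0 = w 1 + w 2 + w 4 := by rw [hqw]; simp; ring
  have e4 : 1 + q 1 - q 2 = w 1 + w 2 + w 3 := by rw [← q4, hqw]; simp; ring
  rw [e1, e4, e2, e3]
  ring

/-- The excess is `-n` for `rep 2`. For `rep 3` and `rep 4` the first lower parameter is `(x + u +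
v) + (x + y + z) = 1 - n`, a non-positive integer because `n ≥ 1`. -/
theorem not_convergentParams_rep {n : ℕ} (hn : 1 ≤ n) {w : Params} (hw : w ∈ symPlane n)
    {i : Fin 5} (h0 : i ≠ 0) (h1 : i ≠ 1) :
    ¬ ConvergentParams (fromSymmetric (w ∘ rep i)) := by
  obtain ⟨hw1, hw2⟩ := hw
  rintro ⟨hd, -, hs⟩
  rw [parametricExcess_fromSymmetric] at hs
  rw [fromSymmetric_apply] at hd
  have hd' : ∀ z : ℂ, z = 1 - n → IsNonposInt z := fun z hz =>
    ⟨n - 1, by rw [hz, Nat.cast_sub hn]; push_cast; ring⟩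
  fin_cases i
  · exact h0 rfl
  · exact h1 rfl
  · have : (w ∘ rep 2) 0 + (w ∘ rep 2) 1 + (w ∘ rep 2) 2 = -(n : ℂ) := by
      simpa [rep] using hw1
    simp only [Fin.reduceFinMk] at hs
    rw [this] at hs
    have hn0 : (0 : ℝ) ≤ n := n.cast_nonneg
    simp at hs
    linarith
  · refine hd (hd' _ ?_)
    simp [rep]
    linear_combination hw1 + hw2
  · refine hd (hd' _ ?_)
    simp [rep]
    linear_combination hw1 + hw2

/-- This is Thomae invariance restricted to the plane: the value does not depend on `τ`. -/
theorem hasNormalizedSum_of_mem_symPlane {n : ℕ} (hn : 1 ≤ n) {w : Params} (hw : w ∈ symPlane n)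
    (τ : Equiv.Perm (Fin 5)) (hq : ConvergentParams (fromSymmetric (w ∘ τ))) :
    HasNormalizedSum (fromSymmetric (w ∘ τ)) (normValue n w) := by
  obtain ⟨i, h, hh, k, hk, rfl⟩ := exists_eq_mul_rep_mul τ
  have e : w ∘ (h * rep i * k) = ((w ∘ h) ∘ rep i) ∘ k := rfl
  obtain ⟨hw', hN⟩ := symPlane_normValue_comp hw hh
  rw [e, fromSymmetric_comp hk, convergentParams_comp hk] at hq
  rw [e, fromSymmetric_comp hk, hasNormalizedSum_comp hk, ← hN]
  by_cases h0 : i = 0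
  · subst h0
    exact hasNormalizedSum_rep_zero hw' hq
  by_cases h1 : i = 1
  · subst h1
    exact hasNormalizedSum_rep_one hn hw' hq
  exact absurd hq (not_convergentParams_rep hn hw' h0 h1)

/-! ### The planes as affine subspaces -/

/-- The direction of the base plane. -/
noncomputable def baseDirection : (Fin 3 → ℂ) →ₗ[ℂ] Params :=
  Matrix.vecMulLinear !![0, 1, 0, 0, 1; 0, 0, 1, 0, 1; 0, 0, 0, 1, -1]

theorem baseDirection_apply (v : Fin 3 → ℂ) :
    baseDirection v = ![0, v 0, v 1, v 2, v 0 + v 1 - v 2] := by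
  change Matrix.vecMul v _ = _
  ext j
  fin_cases j <;> simp [Matrix.vecMul, dotProduct, Fin.sum_univ_three] <;> ring

theorem baseDirection_injective : Function.Injective baseDirection := by
  intro v v' h
  rw [baseDirection_apply, baseDirection_apply] at h
  have h1 := congrFun h 1
  have h2 := congrFun h 2
  have h3 := congrFun h 3
  ext j
  fin_cases j
  · simpa using h1
  · simpa using h2
  · simpa using h3

/-- The plane `{(-n, a, b; c, 1 + a + b - c - n)}`. -/
noncomputable def basePlane (n : ℕ) : AffineSubspace ℂ Params :=
  AffineSubspace.mk' ![-(n : ℂ), 0, 0, 0, 1 - n] (LinearMap.range baseDirection)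

/-- The image of the base plane under the permutation `τ` of the symmetric coordinates. -/
noncomputable def orbitPlane (n : ℕ) (τ : Equiv.Perm (Fin 5)) : AffineSubspace ℂ Params :=
  imagePlane (thomaeMap τ) (basePlane n)

theorem mem_imagePlane {T : Params ≃ₗ[ℂ] Params} {V : AffineSubspace ℂ Params} {p : Params} :
    p ∈ imagePlane T V ↔ ∃ q ∈ V, T q = p := by
  simp [imagePlane, AffineSubspace.mem_map]

theorem mem_basePlane {n : ℕ} {p : Params} :
    p ∈ basePlane n ↔ p 0 = -(n : ℂ) ∧ parametricExcess p = 1 := by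
  rw [basePlane, AffineSubspace.mem_mk', LinearMap.mem_range]
  constructor
  · rintro ⟨v, hv⟩
    rw [baseDirection_apply] at hv
    have h := fun j => congrFun hv j
    have h0 := h 0
    have h1 := h 1
    have h2 := h 2
    have h3 := h 3
    have h4 := h 4
    simp at h0 h1 h2 h3 h4
    refine ⟨by linear_combination -h0, ?_⟩
    rw [parametricExcess]
    linear_combination h0 + h1 + h2 - h3 - h4
  · rintro ⟨h0, hs⟩
    rw [parametricExcess] at hs
    refine ⟨![p 1, p 2, p 3], ?_⟩
    rw [baseDirection_apply]
    ext j
    fin_cases j <;> simp [h0]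
    linear_combination -h0 - hs

theorem fromSymmetric_mem_basePlane {n : ℕ} {w : Params} :
    fromSymmetric w ∈ basePlane n ↔ w ∈ symPlane n := by
  rw [mem_basePlane, parametricExcess_fromSymmetric, fromSymmetric_apply]
  rfl

theorem fromSymmetric_mem_orbitPlane {n : ℕ} {τ : Equiv.Perm (Fin 5)} {y : Params} :
    fromSymmetric y ∈ orbitPlane n τ ↔ y ∘ τ.symm ∈ symPlane n := by
  rw [orbitPlane, mem_imagePlane, ← fromSymmetric_mem_basePlane]
  constructor
  · rintro ⟨q, hq, h⟩
    obtain ⟨w, rfl⟩ := fromSymmetric.surjective q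
    rw [thomaeMap_fromSymmetric] at h
    rw [← fromSymmetric.injective h]
    simpa [Function.comp_assoc] using hq
  · intro h
    exact ⟨_, h, by rw [thomaeMap_fromSymmetric]; simp [Function.comp_assoc]⟩

theorem mem_orbitPlane {n : ℕ} {τ : Equiv.Perm (Fin 5)} {p : Params} :
    p ∈ orbitPlane n τ ↔ ∃ w ∈ symPlane n, fromSymmetric (w ∘ τ) = p := by
  constructor
  · obtain ⟨y, rfl⟩ := fromSymmetric.surjective p
    rw [fromSymmetric_mem_orbitPlane]
    exact fun h => ⟨_, h, by simp [Function.comp_assoc]⟩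
  · rintro ⟨w, hw, rfl⟩
    rw [fromSymmetric_mem_orbitPlane]
    simpa [Function.comp_assoc] using hw

theorem isThreePlane_orbitPlane (n : ℕ) (τ : Equiv.Perm (Fin 5)) :
    IsThreePlane (orbitPlane n τ) := by
  constructor
  · refine ⟨thomaeMap τ ![-(n : ℂ), 0, 0, 0, 1 - n], ?_⟩
    exact mem_imagePlane.2 ⟨_, AffineSubspace.self_mem_mk' _ _, rfl⟩
  · rw [orbitPlane, imagePlane, AffineSubspace.map_direction, basePlane,
      AffineSubspace.direction_mk', LinearMap.toAffineMap_linear, LinearEquiv.finrank_map_eq,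
      LinearMap.finrank_range_of_inj baseDirection_injective]
    simp

/-! ### Gamma quotients on the planes -/

/-- The affine function with constant term `q` and coefficients `c` in the symmetric coordinates. -/
def symAffine (q : ℚ) (c : Fin 5 → ℚ) : RatAffine where
  const := q
  -- The matrix is the rational copy of `thomaeAInv`.
  coeff i := ∑ j, c j * (!![1/3, -2/3, -2/3, 1/3, 1/3; -2/3, 1/3, -2/3, 1/3, 1/3;
    -2/3, -2/3, 1/3, 1/3, 1/3; 1/3, 1/3, 1/3, 1/3, -2/3;
    1/3, 1/3, 1/3, -2/3, 1/3] : Matrix (Fin 5) (Fin 5) ℚ) i j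

theorem symAffine_eval (q : ℚ) (c : Fin 5 → ℚ) (w : Params) :
    (symAffine q c).eval (fromSymmetric w) = q + ∑ j, (c j : ℂ) * w j := by
  rw [RatAffine.eval, fromSymmetric_apply]
  simp [symAffine, Fin.sum_univ_five]
  ring

theorem symAffine_comp_eval (q : ℚ) (c : Fin 5 → ℚ) (w : Params) (τ : Equiv.Perm (Fin 5)) :
    (symAffine q (c ∘ τ)).eval (fromSymmetric (w ∘ τ)) = q + ∑ j, (c j : ℂ) * w j := by
  rw [symAffine_eval]
  congr 1
  exact Equiv.sum_comp τ fun j => (c j : ℂ) * w j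

theorem hasFormalGammaQuotientSummation_orbitPlane {n : ℕ} (hn : 1 ≤ n)
    (τ : Equiv.Perm (Fin 5)) :
    HasFormalGammaQuotientSummation (orbitPlane n τ : Set Params) := by
  -- This is `normValue` with each `(z)_n` written as `Γ(z + n) / Γ(z)`; composing the coefficients
  -- with `τ` undoes the permutation of the coordinates.
  refine ⟨[symAffine n (![1, 0, 1, 1, 0] ∘ τ), symAffine n (![1, 0, 1, 0, 1] ∘ τ)],
    [symAffine 0 (![1, 0, 1, 1, 0] ∘ τ), symAffine 0 (![1, 0, 1, 0, 1] ∘ τ),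
      symAffine 0 (![0, 1, 1, 1, 0] ∘ τ), symAffine 0 (![0, 1, 1, 0, 1] ∘ τ)], ?_⟩
  rintro p hp _ ⟨σ, rfl⟩ hconv
  obtain ⟨w, hw, rfl⟩ := mem_orbitPlane.1 hp
  rw [thomaeMap_fromSymmetric] at hconv ⊢
  obtain ⟨F, hF, hN⟩ := hasNormalizedSum_of_mem_symPlane hn hw (τ * σ) hconv
  refine ⟨F, hF, ?_⟩
  have hN' : F / (Complex.Gamma (fromSymmetric ((w ∘ τ) ∘ σ) 3) *
      Complex.Gamma (fromSymmetric ((w ∘ τ) ∘ σ) 4) *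
      Complex.Gamma (parametricExcess (fromSymmetric ((w ∘ τ) ∘ σ)))) = normValue n w := hN
  rw [hN']
  have hsymm : ∀ v : Params, fromSymmetric.symm (fromSymmetric (v ∘ τ)) ∘ τ.symm = v := by
    intro v; simp [Function.comp_assoc]
  refine IsGammaQuotientValue.of_continuousAt
    (fun p => normValue n (fromSymmetric.symm p ∘ τ.symm)) ?_ ?_ ?_ ?_
  · have hc : Continuous fun p : Params => fromSymmetric.symm p :=
      LinearMap.continuous_of_finiteDimensional (fromSymmetric.symm : Params →ₗ[ℂ] Params)
    have hr := continuous_rising n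
    have hi := continuous_inv_Gamma
    have hcj : ∀ j, Continuous fun p : Params => fromSymmetric.symm p j := fun j =>
      (continuous_apply j).comp hc
    refine Continuous.continuousAt ?_
    simp only [normValue, Function.comp_apply]
    have h3 : ∀ i j k, Continuous fun p : Params => fromSymmetric.symm p i +
        fromSymmetric.symm p j + fromSymmetric.symm p k := fun i j k =>
      ((hcj i).add (hcj j)).add (hcj k)
    exact (((hr.comp (h3 _ _ _)).mul (hr.comp (h3 _ _ _))).mul (hi.comp (h3 _ _ _))).mul
      (hi.comp (h3 _ _ _))
  · rw [hsymm]
  · rintro q ⟨hq, hreg⟩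
    obtain ⟨v, hv, rfl⟩ := mem_orbitPlane.1 hq
    rw [hsymm]
    simp only [regularSet, List.map_cons, List.map_nil, List.mem_cons, List.not_mem_nil, or_false,
      forall_eq_or_imp, forall_eq, Set.mem_ofPred_eq, symAffine_comp_eval] at hreg
    simp only [gammaQuotient, List.map_cons, List.map_nil, List.prod_cons, List.prod_nil, mul_one,
      symAffine_comp_eval]
    simp [Fin.sum_univ_five] at hreg ⊢
    obtain ⟨h1, h2⟩ := hreg
    rw [add_comm (n : ℂ)] at h1 h2
    rw [add_comm (n : ℂ), add_comm (n : ℂ), normValue, ← Gamma_add_nat_mul_inv h1,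
      ← Gamma_add_nat_mul_inv h2]
    simp only [div_eq_mul_inv, mul_inv]
    ring
  · refine mem_closure_of_line
      -- Trading `y` for `z` stays in the plane and gives both numerator arguments slope `1`.
      (fun t => fromSymmetric ((w + t • ![0, -1, 1, 0, 0]) ∘ τ)) ?_ (by simp) ?_
    · have hc : Continuous fun p : Params => fromSymmetric p :=
        LinearMap.continuous_of_finiteDimensional (fromSymmetric : Params →ₗ[ℂ] Params)
      refine hc.comp (continuous_pi fun j => ?_)
      simp only [Function.comp_apply, Pi.add_apply, Pi.smul_apply]
      fun_prop
    · have h := fun z => eventually_not_isNonposInt_line z one_ne_zero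
      filter_upwards [h (n + (w 0 + w 2 + w 3)), h (n + (w 0 + w 2 + w 4))] with t h1 h2
      refine ⟨mem_orbitPlane.2 ⟨_, ?_, rfl⟩, ?_⟩
      · obtain ⟨e1, e2⟩ := hw
        refine ⟨?_, ?_⟩
        · simpa using e1
        · simp; linear_combination e2
      · simp only [regularSet, List.map_cons, List.map_nil, List.mem_cons, List.not_mem_nil,
          or_false, forall_eq_or_imp, forall_eq, Set.mem_ofPred_eq, symAffine_comp_eval]
        simp [Fin.sum_univ_five]
        refine ⟨?_, ?_⟩
        · convert h1 using 2; ring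
        · convert h2 using 2; ring

/-- The formal summation property implies the summation property. -/
theorem HasFormalGammaQuotientSummation.hasGammaQuotientSummation {V : Set Params}
    (hV : HasFormalGammaQuotientSummation V) : HasGammaQuotientSummation V := by
  obtain ⟨num, den, h⟩ := hV
  refine ⟨⟨0, ![0, 0, 0, 1, 0]⟩ :: ⟨0, ![0, 0, 0, 0, 1]⟩ :: ⟨0, ![-1, -1, -1, 1, 1]⟩ :: num, den,
    fun p hp hconv => ?_⟩
  obtain ⟨w, hw, hcl, hlim⟩ := h p hp 1 thomaeGroup.one_mem hconv
  obtain ⟨hd, he, hs⟩ := hconv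
  have hs' := not_isNonposInt_of_re_pos hs
  refine ⟨w, hw, ?_⟩
  have e1 : RatAffine.eval ⟨0, ![0, 0, 0, 1, 0]⟩ = fun q => q 3 := by
    ext q; simp [RatAffine.eval, Fin.sum_univ_five]
  have e2 : RatAffine.eval ⟨0, ![0, 0, 0, 0, 1]⟩ = fun q => q 4 := by
    ext q; simp [RatAffine.eval, Fin.sum_univ_five]
  have e3 : RatAffine.eval ⟨0, ![-1, -1, -1, 1, 1]⟩ = parametricExcess := by
    ext q; simp [RatAffine.eval, Fin.sum_univ_five, parametricExcess]; ring
  have hcs : Continuous parametricExcess := by unfold parametricExcess; fun_prop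
  have hc3 : Continuous fun q : Params => q 3 := continuous_apply 3
  have hc4 : Continuous fun q : Params => q 4 := continuous_apply 4
  simp only [List.map_cons, e1, e2, e3]
  set N := num.map RatAffine.eval
  set D := den.map RatAffine.eval
  -- The three new gamma factors are regular near a convergent point, so shrinking the regular set
  -- changes nothing locally.
  have hnear : ∀ᶠ q in 𝓝 p, ¬ IsNonposInt (q 3) ∧ ¬ IsNonposInt (q 4) ∧
      ¬ IsNonposInt (parametricExcess q) :=
    ((hc3.tendsto p).eventually (eventually_nhds_not_isNonposInt hd)).and
      (((hc4.tendsto p).eventually (eventually_nhds_not_isNonposInt he)).and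
        ((hcs.tendsto p).eventually (eventually_nhds_not_isNonposInt hs')))
  have hreg : ∀ q, q ∈ regularSet ((fun q : Params => q 3) :: (fun q => q 4) ::
      parametricExcess :: N) ↔ (¬ IsNonposInt (q 3) ∧ ¬ IsNonposInt (q 4) ∧
      ¬ IsNonposInt (parametricExcess q)) ∧ q ∈ regularSet N := by
    intro q
    simp [regularSet, and_assoc]
  constructor
  · rw [mem_closure_iff_frequently] at hcl ⊢
    refine (hcl.and_eventually hnear).mono fun q hq => ?_
    exact ⟨hq.1.1, (hreg q).2 ⟨hq.2, hq.1.2⟩⟩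
  · have hprod : Tendsto (fun q : Params => Complex.Gamma (q 3) * Complex.Gamma (q 4) *
        Complex.Gamma (parametricExcess q)) (𝓝 p) (𝓝 (Complex.Gamma (p 3) * Complex.Gamma (p 4) *
        Complex.Gamma (parametricExcess p))) :=
      (((continuousAt_Gamma' hd).tendsto.comp (hc3.tendsto p)).mul
        ((continuousAt_Gamma' he).tendsto.comp (hc4.tendsto p))).mul
          ((continuousAt_Gamma' hs').tendsto.comp (hcs.tendsto p))
    have hne : Complex.Gamma (p 3) * Complex.Gamma (p 4) *
        Complex.Gamma (parametricExcess p) ≠ 0 :=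
      mul_ne_zero (mul_ne_zero (Gamma_ne_zero' hd) (Gamma_ne_zero' he)) (Gamma_ne_zero' hs')
    have hlim' := (hlim.mono_left (nhdsWithin_mono p (s := V ∩ regularSet
      ((fun q : Params => q 3) :: (fun q => q 4) :: parametricExcess :: N))
      fun q hq => ⟨hq.1, ((hreg q).1 hq.2).2⟩)).mul (hprod.mono_left nhdsWithin_le_nhds)
    have hw' : w / (Complex.Gamma ((1 : Params ≃ₗ[ℂ] Params) p 3) *
        Complex.Gamma ((1 : Params ≃ₗ[ℂ] Params) p 4) *
        Complex.Gamma (parametricExcess ((1 : Params ≃ₗ[ℂ] Params) p))) *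
        (Complex.Gamma (p 3) * Complex.Gamma (p 4) * Complex.Gamma (parametricExcess p)) = w :=
      div_mul_cancel₀ w hne
    rw [hw'] at hlim'
    refine hlim'.congr fun q => ?_
    simp only [gammaQuotient, List.map_cons, List.prod_cons]
    ring

/-! ### The orbit up to separate permutations -/

theorem separatePermEquiv_orbitPlane (n : ℕ) (τ : Equiv.Perm (Fin 5)) :
    ∃ i, SeparatePermEquiv (orbitPlane n (rep i)) (orbitPlane n τ) := by
  obtain ⟨i, h, hh, k, hk, rfl⟩ := exists_eq_mul_rep_mul τ
  have hinv : ∀ h ∈ planeSwaps, h⁻¹ ∈ planeSwaps := by decide +kernel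
  refine ⟨i, k, hk, ?_⟩
  ext p
  rw [mem_imagePlane, mem_orbitPlane]
  constructor
  · rintro ⟨w, hw, rfl⟩
    refine ⟨_, mem_orbitPlane.2 ⟨w ∘ h, (symPlane_normValue_comp hw hh).1, rfl⟩, ?_⟩
    exact (fromSymmetric_comp hk ((w ∘ h) ∘ rep i)).symm
  · rintro ⟨q, hq, rfl⟩
    obtain ⟨w, hw, rfl⟩ := mem_orbitPlane.1 hq
    refine ⟨w ∘ (h⁻¹ : Equiv.Perm (Fin 5)), (symPlane_normValue_comp hw (hinv h hh)).1, ?_⟩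
    refine Eq.trans ?_ (fromSymmetric_comp hk (w ∘ rep i))
    congr 1
    ext j
    simp

/-- A condition on points, invariant under separate permutations, that holds on the plane
with index `j`. -/
def PlaneInvariant (n : ℕ) (j : Fin 5) (p : Params) : Prop :=
  (![parametricExcess p = 1, True, parametricExcess p = -n,
    (p 3 = 1 - n ∨ p 4 = 1 - n) ∧ (p 0 = -n ∨ p 1 = -n ∨ p 2 = -n),
    (p 3 = 1 - n ∨ p 4 = 1 - n) ∧ (p 0 = 1 ∨ p 1 = 1 ∨ p 2 = 1)] : Fin 5 → Prop) j

theorem planeInvariant_comp {k : Equiv.Perm (Fin 5)} (hk : IsSeparate k) (n : ℕ) (j : Fin 5)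
    (p : Params) : PlaneInvariant n j (p ∘ k) ↔ PlaneInvariant n j p := by
  rw [PlaneInvariant, parametricExcess_comp hk, PlaneInvariant]
  have h2 : ∀ z : ℂ, (p (k 3) = z ∨ p (k 4) = z) ↔ (p 3 = z ∨ p 4 = z) := by
    intro z
    rcases (IsSeparate.cases k hk).2 with ⟨h3, h4⟩ | ⟨h3, h4⟩ <;> rw [h3, h4]
    tauto
  have h3 : ∀ z : ℂ, (p (k 0) = z ∨ p (k 1) = z ∨ p (k 2) = z) ↔
      (p 0 = z ∨ p 1 = z ∨ p 2 = z) := by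
    intro z
    rcases (IsSeparate.cases k hk).1 with ⟨h0, h1, h2⟩ | ⟨h0, h1, h2⟩ | ⟨h0, h1, h2⟩ |
      ⟨h0, h1, h2⟩ | ⟨h0, h1, h2⟩ | ⟨h0, h1, h2⟩ <;> rw [h0, h1, h2] <;> tauto
  simp only [Function.comp_apply, h2, h3]

theorem planeInvariant_of_mem {n : ℕ} {j : Fin 5} {p : Params}
    (hp : p ∈ orbitPlane n (rep j)) : PlaneInvariant n j p := by
  obtain ⟨w, ⟨h1, h2⟩, rfl⟩ := mem_orbitPlane.1 hp
  rw [PlaneInvariant, parametricExcess_fromSymmetric, fromSymmetric_apply]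
  fin_cases j
  · simpa [rep] using h2
  · trivial
  · simpa [rep] using h1
  · simp [rep]
    exact ⟨Or.inl (by linear_combination h1 + h2), Or.inl (by linear_combination h1)⟩
  · simp [rep]
    exact ⟨Or.inl (by linear_combination h1 + h2), Or.inl (by linear_combination h2)⟩

/-- Plane `1` has only the trivial invariant. This suffices for separating the planes, since of two
distinct indices at least one differs from `1`. -/
theorem exists_mem_not_planeInvariant (n : ℕ) {i j : Fin 5} (hij : i ≠ j) (hj : j ≠ 1) :
    ∃ p ∈ orbitPlane n (rep i), ¬ PlaneInvariant n j p := by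
  have hn : (0 : ℝ) ≤ n := n.cast_nonneg
  have hn1 : (1 : ℝ) ≠ -n := by linarith
  have hn2 : -(n : ℝ) ≠ 1 := by linarith
  -- With imaginary parts `0, 3, -3, 1, -1`, the only real sums of three coordinates are the two
  -- prescribed by the plane. The coordinates add up to `1 - n`, so a lower parameter equals `1 - n`
  -- only if its own coordinate is the zero one.
  refine ⟨_, mem_orbitPlane.2 ⟨![0, 3 * Complex.I, 1 - 3 * Complex.I, Complex.I,
    -n - Complex.I], ?_, rfl⟩, ?_⟩
  · constructor <;> simp
  · rw [PlaneInvariant, parametricExcess_fromSymmetric, fromSymmetric_apply]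
    fin_cases i <;> fin_cases j <;> first | exact absurd rfl hij | exact absurd rfl hj | skip
    all_goals
      simp [rep, Complex.ext_iff]
      try norm_num
      try intros
      try linarith

theorem index_unique {n : ℕ} {W : AffineSubspace ℂ Params} {i j : Fin 5}
    (hi : SeparatePermEquiv (orbitPlane n (rep i)) W)
    (hj : SeparatePermEquiv (orbitPlane n (rep j)) W) (hj1 : j ≠ 1) : i = j := by
  by_contra hij
  obtain ⟨p, hp, hpj⟩ := exists_mem_not_planeInvariant n hij hj1
  obtain ⟨σ, hσ, rfl⟩ := hi
  obtain ⟨σ', hσ', hW⟩ := hj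
  have hmem : p ∘ σ ∈ imagePlane (LinearEquiv.funCongrLeft ℂ ℂ σ) (orbitPlane n (rep i)) :=
    mem_imagePlane.2 ⟨p, hp, rfl⟩
  rw [hW] at hmem
  obtain ⟨q, hq, hqp⟩ := mem_imagePlane.1 hmem
  have hqp' : q ∘ σ' = p ∘ σ := hqp
  apply hpj
  rw [← planeInvariant_comp hσ, ← hqp', planeInvariant_comp hσ']
  exact planeInvariant_of_mem hq

/-! ### Explicit form of the two convergent planes, and the main theorem -/

theorem orbitPlane_rep_zero (n : ℕ) : (orbitPlane n (rep 0) : Set Params) =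
    {p | ∃ a b c : ℂ, p = ![-(n : ℂ), a, b, c, 1 + a + b - c - n]} := by
  ext p
  obtain ⟨y, rfl⟩ := fromSymmetric.surjective p
  have h : fromSymmetric y ∈ orbitPlane n (rep 0) ↔ fromSymmetric y ∈ basePlane n := by
    rw [fromSymmetric_mem_orbitPlane, fromSymmetric_mem_basePlane]; rfl
  rw [SetLike.mem_coe, h, mem_basePlane, parametricExcess, Set.mem_ofPred_eq]
  generalize fromSymmetric y = q
  constructor
  · rintro ⟨h0, hs⟩
    refine ⟨q 1, q 2, q 3, ?_⟩
    ext j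
    fin_cases j <;> simp [h0]
    linear_combination h0 + hs
  · rintro ⟨a, b, c, rfl⟩
    exact ⟨by simp, by simp; ring⟩

theorem orbitPlane_rep_one (n : ℕ) : (orbitPlane n (rep 1) : Set Params) =
    {p | ∃ a b c : ℂ, p = ![a, b, c, a - n, 1 + b]} := by
  ext p
  rw [SetLike.mem_coe, Set.mem_ofPred_eq]
  constructor
  · intro hp
    obtain ⟨w, ⟨h1, h2⟩, rfl⟩ := mem_orbitPlane.1 hp
    generalize hq : fromSymmetric (w ∘ rep 1) = q
    rw [fromSymmetric_apply] at hq
    simp [rep] at hq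
    refine ⟨q 0, q 1, q 2, ?_⟩
    rw [← hq]
    ext j
    fin_cases j <;> simp
    · linear_combination h1
    · linear_combination h2
  · rintro ⟨a, b, c, h⟩
    obtain ⟨y, rfl⟩ := fromSymmetric.surjective p
    rw [fromSymmetric_mem_orbitPlane]
    rw [fromSymmetric_apply] at h
    have h0 := congrFun h 0
    have h1 := congrFun h 1
    have h3 := congrFun h 3
    have h4 := congrFun h 4
    simp at h0 h1 h3 h4
    constructor
    · simp [rep]; linear_combination h3 - h0
    · simp [rep]; linear_combination h4 - h1

theorem mainTheorem10 (n : ℕ) (hn : 1 ≤ n) :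
    ∃ O : Set (AffineSubspace ℂ Params), IsThomaeOrbit O ∧
      (∀ W ∈ O, IsThreePlane W ∧ HasGammaQuotientSummation (W : Set Params) ∧
        HasFormalGammaQuotientSummation (W : Set Params)) ∧
      ∃ V : Fin 5 → AffineSubspace ℂ Params,
        (∀ i, V i ∈ O) ∧
        (∀ W ∈ O, ∃! i, SeparatePermEquiv (V i) W) ∧
        -- the first identity (Pfaff-Saalschuetz)
        (V 0 : Set Params) = {p | ∃ a b c : ℂ, p = ![-(n : ℂ), a, b, c, 1 + a + b - c - n]} ∧
        (∀ a b c : ℂ, ¬ IsNonposInt c → ¬ IsNonposInt (1 + a + b - c - n) →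
          ∃ w : ℂ, HasSum (hyperTerm ![-(n : ℂ), a, b, c, 1 + a + b - c - n]) w ∧
            IsGammaQuotientValue (X := ℂ × ℂ × ℂ) Set.univ
              [fun (a, b, c) => c - a + n, fun (a, b, c) => c - b + n,
                fun (_, _, c) => c, fun (a, b, c) => c - a - b]
              [fun (a, _, c) => c - a, fun (_, b, c) => c - b,
                fun (_, _, c) => c + n, fun (a, b, c) => c - a - b + n]
              (a, b, c) w) ∧
        -- the second identity
        (V 1 : Set Params) = {p | ∃ a b c : ℂ, p = ![a, b, c, a - n, 1 + b]} ∧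
        (∀ a b c : ℂ, ¬ IsNonposInt (a - n) → ¬ IsNonposInt (1 + b) →
          0 < ((a - n) + (1 + b) - a - b - c).re →
          ∃ w : ℂ, HasSum (hyperTerm ![a, b, c, a - n, 1 + b]) w ∧
            IsGammaQuotientValue (X := ℂ × ℂ × ℂ) Set.univ
              [fun (a, b, _) => 1 + b - a + n, fun (a, _, _) => 1 - a,
                fun (_, _, c) => 1 - c, fun (_, b, _) => 1 + b]
              [fun (a, b, _) => 1 + b - a, fun (a, _, _) => 1 - a + n,
                fun (_, b, c) => 1 + b - c]
              (a, b, c) w) ∧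
        -- the remaining three planes
        (∀ i, i ≠ 0 → i ≠ 1 → ∀ p ∈ V i, ¬ ConvergentParams p) := by
  refine ⟨{W | ∃ T ∈ thomaeGroup, W = imagePlane T (basePlane n)}, ⟨basePlane n, rfl⟩, ?_,
    fun i => orbitPlane n (rep i), fun i => ⟨thomaeMap (rep i), ⟨rep i, rfl⟩, rfl⟩, ?_,
    orbitPlane_rep_zero n, saalschuetz_isGammaQuotientValue n, orbitPlane_rep_one n,
    shifted_isGammaQuotientValue hn, ?_⟩
  · rintro _ ⟨_, ⟨τ, rfl⟩, rfl⟩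
    have h := hasFormalGammaQuotientSummation_orbitPlane hn τ
    exact ⟨isThreePlane_orbitPlane n τ, h.hasGammaQuotientSummation, h⟩
  · rintro _ ⟨_, ⟨τ, rfl⟩, rfl⟩
    obtain ⟨i, hi⟩ := separatePermEquiv_orbitPlane n τ
    refine ⟨i, hi, fun j hj => ?_⟩
    -- `index_unique` needs one index different from `1`, so the roles of `i` and `j` are exchanged
    -- when `i = 1`.
    by_cases h1 : i = 1
    · by_cases hj1 : j = 1
      · rw [hj1, h1]
      · exact (index_unique hi hj hj1).symm
    · exact index_unique hj hi h1
  · intro i h0 h1 p hp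
    obtain ⟨w, hw, rfl⟩ := mem_orbitPlane.1 hp
    exact not_convergentParams_rep hn hw h0 h1
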